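/- Lemma 3.1. Let $d\ge 1$, let $A_1,\dots,A_m\in M_d(\mathbb C)$ be self-adjoint, and let $\mathcal A_{\mathbb Z}$ be the UHF algebra of the infinite spin chain, i.e. the $C^*$-inductive limit of the algebras $\mathcal A_\Lambda=\bigotimes_\Lambda M_d(\mathbb C)$, $\Lambda\subset\mathbb Z$ finite, with lattice translations $\gamma_j$ ($j\in\mathbb Z$); write $\mathcal A_n=\mathcal A_{[-n,n]}$ and regard $M_d(\mathbb C)$ as the algebra of the site $0$. Let $S_\gamma$ be the set of translation invariant states $\omega$ of $\mathcal A_{\mathbb Z}$, and let $s(\omega)=\lim_{n\to\infty}\frac1{2n+1}S_{[-n,n]}(\omega)$ be the mean entropy, where $S_{[-n,n]}(\omega)$ is the von Neumann entropy of $\omega|_{\mathcal A_n}$ (the limit exists). For $x\in\mathbb R^m$ put $$\mu(x)=\sup\{s(\omega):\omega\in S_\gamma,\ \omega(A_i)=x_i\ (1\le i\le m)\}\in[-\infty,\infty),$$ with $\mu(x)=-\infty$ if there is no such $\omega$, and $\mathrm{dom}\,\mu=\{x\in\mathbb R^m:\mu(x)>-\infty\}$. Let $H_{i,n}=\frac1{2n+1}\sum_{j=-n}^n\gamma_j(A_i)\in\mathcal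 A_n$, and let $n_1<n_2<\cdots$ be any strictly increasing sequence in $\mathbb N$. Let $B=\prod_k\mathcal A_{n_k}$ be the $C^*$-algebra of norm-bounded sequences, $D=\bigoplus_k\mathcal A_{n_k}$ its closed ideal of sequences $(x_k)$ with $\|x_k\|\to0$, and $\pi:B\to A:=B/D$ the quotient map. The self-adjoint elements $\pi((H_{i,n_k})_k)$, $i=1,\dots,m$, of $A$ commute. Let $R>\max_i\|A_i\|$, $X=[-R,R]^m$, let $\varphi:C(X)\to A$ be the $*$-homomorphism given by the joint continuous functional calculus $$\varphi(f)=f\big(\pi((H_{1,n_k})_k),\dots,\pi((H_{m,n_k})_k)\big),$$ and let $S$ be the set of all $x\in X$ such that for every neighbourhood $U$ of $x$ in $X$ there is $f\in C(X)$ with $\operatorname{supp} f\subset U$ and $\varphi(f)\ne0$. Then $$\mathrm{dom}\,\mu=S.$$ -/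

import Mathlib

open Filter Topology Set
open scoped ENNReal Matrix.Norms.L2Operator

noncomputable section
namespace SpinChain

section SeqQuotient

variable (E : ℕ → Type) [∀ k, CStarAlgebra (E k)] [∀ k, Nontrivial (E k)]

/-- The C*-algebra `B = ∏ₖ Eₖ` of norm-bounded sequences with the supremum norm. -/
abbrev BddSeq : Type := lp E ∞

/-- The ideal `D = ⊕ₖ Eₖ` of sequences whose norms tend to `0`. -/
def nullIdeal : Ideal (BddSeq E) where
  carrier := {x | Tendsto (fun k => ‖x k‖) atTop (𝓝 0)}
  zero_mem' := by simp
  add_mem' := by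
    intro a b ha hb
    refine squeeze_zero (fun k => norm_nonneg _) (fun k => norm_add_le (a k) (b k)) ?_
    simpa using Tendsto.add ha hb
  smul_mem' := by
    intro c x hx
    refine squeeze_zero (g := fun k => ‖c‖ * ‖x k‖) (fun k => norm_nonneg _) (fun k => ?_) ?_
    · exact (norm_mul_le (c k) (x k)).trans
        (mul_le_mul_of_nonneg_right (lp.norm_apply_le_norm ENNReal.top_ne_zero c k)
          (norm_nonneg _))
    · simpa using Tendsto.const_mul ‖c‖ hx

theorem mem_nullIdeal {x : BddSeq E} :
    x ∈ nullIdeal E ↔ Tendsto (fun k => ‖x k‖) atTop (𝓝 0) := Iff.rfl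

instance : (nullIdeal E).IsTwoSided where
  mul_mem_of_left := by
    intro x c hx
    refine squeeze_zero (g := fun k => ‖x k‖ * ‖c‖) (fun k => norm_nonneg _) (fun k => ?_) ?_
    · exact (norm_mul_le (x k) (c k)).trans
        (mul_le_mul_of_nonneg_left (lp.norm_apply_le_norm ENNReal.top_ne_zero c k)
          (norm_nonneg _))
    · simpa using Tendsto.mul_const ‖c‖ hx

instance nullIdeal_isClosed : IsClosed (nullIdeal E : Set (BddSeq E)) := by
  refine isClosed_of_closure_subset fun x hx => ?_
  rw [Metric.mem_closure_iff] at hx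
  change Tendsto (fun k => ‖x k‖) atTop (𝓝 0)
  rw [Metric.tendsto_atTop]
  intro ε hε
  obtain ⟨y, hy, hxy⟩ := hx (ε / 2) (half_pos hε)
  obtain ⟨N, hN⟩ := (Metric.tendsto_atTop.1 ((mem_nullIdeal E).1 hy)) (ε / 2) (half_pos hε)
  refine ⟨N, fun k hk => ?_⟩
  have h1 := hN k hk
  have h2 : ‖x k - y k‖ ≤ ‖x - y‖ := lp.norm_apply_le_norm ENNReal.top_ne_zero (x - y) k
  rw [dist_eq_norm] at hxy
  simp only [dist_zero_right, norm_norm] at h1 ⊢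
  have h3 : ‖x k‖ ≤ ‖x k - y k‖ + ‖y k‖ := by
    simpa using norm_add_le (x k - y k) (y k)
  linarith

theorem star_mem_nullIdeal {x : BddSeq E} (hx : x ∈ nullIdeal E) : star x ∈ nullIdeal E := by
  rw [mem_nullIdeal] at hx ⊢
  simpa using hx

/-- The quotient C*-algebra `A = B / D`. -/
def SeqQuot : Type := BddSeq E ⧸ nullIdeal E

namespace SeqQuot

instance : Ring (SeqQuot E) := inferInstanceAs (Ring (BddSeq E ⧸ nullIdeal E))

instance : Algebra ℂ (SeqQuot E) := inferInstanceAs (Algebra ℂ (BddSeq E ⧸ nullIdeal E))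

instance : NormedAddCommGroup (SeqQuot E) :=
  Submodule.Quotient.normedAddCommGroup (nullIdeal E)

/-- The quotient map `π : B → A`, as a homomorphism of algebras. -/
def mkₐ : BddSeq E →ₐ[ℂ] SeqQuot E := Ideal.Quotient.mkₐ ℂ (nullIdeal E)

variable {E}

theorem mkₐ_surjective : Function.Surjective (mkₐ E) := Ideal.Quotient.mk_surjective

theorem mkₐ_eq_iff {x y : BddSeq E} : mkₐ E x = mkₐ E y ↔ x - y ∈ nullIdeal E :=
  Ideal.Quotient.mk_eq_mk_iff_sub_mem x y

theorem norm_mkₐ_le (x : BddSeq E) : ‖mkₐ E x‖ ≤ ‖x‖ :=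
  Submodule.Quotient.norm_mk_le (S := nullIdeal E) x

theorem exists_norm_lt (x : SeqQuot E) {ε : ℝ} (hε : 0 < ε) :
    ∃ b : BddSeq E, mkₐ E b = x ∧ ‖b‖ < ‖x‖ + ε :=
  Submodule.Quotient.norm_mk_lt (S := nullIdeal E) x hε

instance : NormedRing (SeqQuot E) :=
  { (inferInstance : Ring (SeqQuot E)), (inferInstance : NormedAddCommGroup (SeqQuot E)) with
    norm_mul_le := by
      intro x y
      have key : ∀ ε > 0, ‖x * y‖ ≤ (‖x‖ + ε) * (‖y‖ + ε) := by
        intro ε hε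
        obtain ⟨a, rfl, ha⟩ := exists_norm_lt x hε
        obtain ⟨b, rfl, hb⟩ := exists_norm_lt y hε
        rw [← map_mul]
        exact (norm_mkₐ_le _).trans ((norm_mul_le a b).trans
          (mul_le_mul ha.le hb.le (norm_nonneg _) ((norm_nonneg _).trans ha.le)))
      have hlim : Tendsto (fun ε : ℝ => (‖x‖ + ε) * (‖y‖ + ε)) (𝓝[>] 0) (𝓝 (‖x‖ * ‖y‖)) := by
        have : Tendsto (fun ε : ℝ => (‖x‖ + ε) * (‖y‖ + ε)) (𝓝 0)
            (𝓝 ((‖x‖ + 0) * (‖y‖ + 0))) := by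
          apply Continuous.tendsto (by fun_prop) (0 : ℝ)
        simpa using this.mono_left nhdsWithin_le_nhds
      exact ge_of_tendsto hlim (by filter_upwards [self_mem_nhdsWithin] with ε hε using key ε hε) }

instance : NormedAlgebra ℂ (SeqQuot E) :=
  { (inferInstance : Algebra ℂ (SeqQuot E)) with
    norm_smul_le := by
      intro c x
      have h : ‖c • x‖ ≤ ‖c‖ * ‖x‖ :=
        norm_smul_le (β := BddSeq E ⧸ nullIdeal E) c x
      exact h }

instance : CompleteSpace (SeqQuot E) :=
  Submodule.Quotient.completeSpace (nullIdeal E)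

instance : StarRing (SeqQuot E) where
  star := Quotient.map' star (by
    intro a b hab
    have h : a - b ∈ nullIdeal E := (Submodule.quotientRel_def (nullIdeal E)).1 hab
    refine (Submodule.quotientRel_def (nullIdeal E)).2 ?_
    rw [← star_sub]
    exact star_mem_nullIdeal E h)
  star_involutive := by
    intro x
    obtain ⟨a, rfl⟩ := mkₐ_surjective x
    exact congrArg (mkₐ E) (star_star a)
  star_mul := by
    intro x y
    obtain ⟨a, rfl⟩ := mkₐ_surjective x
    obtain ⟨b, rfl⟩ := mkₐ_surjective y
    exact congrArg (mkₐ E) (star_mul a b)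
  star_add := by
    intro x y
    obtain ⟨a, rfl⟩ := mkₐ_surjective x
    obtain ⟨b, rfl⟩ := mkₐ_surjective y
    exact congrArg (mkₐ E) (star_add a b)

theorem star_mkₐ (a : BddSeq E) : star (mkₐ E a) = mkₐ E (star a) := rfl

instance : StarModule ℂ (SeqQuot E) where
  star_smul c x := by
    obtain ⟨a, rfl⟩ := mkₐ_surjective x
    rw [← map_smul, star_mkₐ, star_mkₐ, star_smul, map_smul]

theorem norm_mkₐ_le_of_eventually {a : BddSeq E} {C : ℝ} (hC : 0 ≤ C)
    (h : ∀ᶠ k in atTop, ‖a k‖ ≤ C) : ‖mkₐ E a‖ ≤ C := by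
  obtain ⟨N, hN⟩ := eventually_atTop.1 h
  have hle : ∀ k, ‖(if N ≤ k then a k else 0 : E k)‖ ≤ ‖a k‖ := by
    intro k
    split_ifs <;> simp
  let a' : BddSeq E := ⟨fun k => if N ≤ k then a k else 0,
    memℓp_infty ⟨‖a‖, by
      rintro _ ⟨k, rfl⟩
      exact (hle k).trans (lp.norm_apply_le_norm ENNReal.top_ne_zero a k)⟩⟩
  have ha' : ∀ k, a' k = if N ≤ k then a k else 0 := fun k => rfl
  have heq : mkₐ E a = mkₐ E a' := by
    rw [mkₐ_eq_iff, mem_nullIdeal]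
    refine tendsto_const_nhds.congr' ?_
    filter_upwards [eventually_ge_atTop N] with k hk
    have : (a - a') k = a k - a' k := rfl
    rw [this, ha' k, if_pos hk, sub_self, norm_zero]
  rw [heq]
  refine (norm_mkₐ_le _).trans (lp.norm_le_of_forall_le hC fun k => ?_)
  rw [ha' k]
  split_ifs with hk
  · exact hN k hk
  · simpa using hC

instance : CStarRing (SeqQuot E) where
  norm_mul_self_le x := by
    obtain ⟨a, rfl⟩ := mkₐ_surjective x
    refine le_of_forall_pos_le_add fun ε hε => ?_
    obtain ⟨b, hb, hbn⟩ := exists_norm_lt (star (mkₐ E a) * mkₐ E a) (half_pos hε)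
    rw [star_mkₐ, ← map_mul] at hb hbn ⊢
    have hnull := (mem_nullIdeal E).1 (mkₐ_eq_iff.1 hb.symm)
    set Q := ‖mkₐ E (star a * a)‖ with hQ
    have hQ0 : 0 ≤ Q := norm_nonneg _
    have hev : ∀ᶠ k in atTop, ‖a k‖ ≤ √(Q + ε) := by
      filter_upwards [hnull.eventually (gt_mem_nhds (half_pos hε))] with k hk
      apply Real.le_sqrt_of_sq_le
      have h1 : ‖a k‖ ^ 2 = ‖star (a k) * a k‖ := by
        rw [CStarRing.norm_star_mul_self, sq]
      have h2 : (star a * a - b) k = star (a k) * a k - b k := rfl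
      have h3 : ‖star (a k) * a k‖ ≤ ‖star (a k) * a k - b k‖ + ‖b k‖ := by
        simpa using norm_add_le (star (a k) * a k - b k) (b k)
      have h4 : ‖b k‖ ≤ ‖b‖ := lp.norm_apply_le_norm ENNReal.top_ne_zero b k
      rw [h2] at hk
      rw [h1]
      linarith
    have h5 := norm_mkₐ_le_of_eventually (Real.sqrt_nonneg _) hev
    calc ‖mkₐ E a‖ * ‖mkₐ E a‖ ≤ √(Q + ε) * √(Q + ε) :=
          mul_le_mul h5 h5 (norm_nonneg _) (Real.sqrt_nonneg _)
      _ = Q + ε := Real.mul_self_sqrt (by linarith)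

instance : CStarAlgebra (SeqQuot E) where

variable (E) in
/-- The quotient map `π : B → A`, as a `*`-homomorphism. -/
def proj : BddSeq E →⋆ₐ[ℂ] SeqQuot E where
  __ := mkₐ E
  map_star' _ := rfl

end SeqQuot
end SeqQuotient

section JointCalculus

variable {A : Type*} [CStarAlgebra A] {m : ℕ}

/-- The cube `X = [-R, R]^m`. -/
def cube (m : ℕ) (R : ℝ) : Set (Fin m → ℝ) := Set.pi Set.univ fun _ => Set.Icc (-R) R

/-- The C*-subalgebra generated by `a₁, …, aₘ` and `1`. -/
def generated (a : Fin m → A) : StarSubalgebra ℂ A :=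
  (StarAlgebra.adjoin ℂ (Set.range a)).topologicalClosure

instance (a : Fin m → A) : IsClosed (generated a : Set A) :=
  StarSubalgebra.isClosed_topologicalClosure _

theorem mem_generated (a : Fin m → A) (i : Fin m) : a i ∈ generated a :=
  StarSubalgebra.le_topologicalClosure _ (StarAlgebra.subset_adjoin ℂ _ ⟨i, rfl⟩)

/-- The C*-algebra generated by commuting self-adjoint elements is commutative. -/
abbrev generatedCommCStar (a : Fin m → A) (hsa : ∀ i, IsSelfAdjoint (a i))
    (hcomm : ∀ i j, Commute (a i) (a j)) : CommCStarAlgebra (generated a) :=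
  { (inferInstance : CStarAlgebra (generated a)) with
    mul_comm := by
      have h1 : IsMulCommutative (StarAlgebra.adjoin ℂ (Set.range a)) :=
        StarAlgebra.isMulCommutative_adjoin ℂ
          (by rintro _ ⟨i, rfl⟩ _ ⟨j, rfl⟩; exact hcomm i j)
          (by rintro _ ⟨i, rfl⟩ _ ⟨j, rfl⟩; rw [(hsa j).star_eq]; exact hcomm i j)
      exact (StarSubalgebra.commSemiringTopologicalClosure _
        (fun x y => h1.is_comm.comm x y)).mul_comm }

theorem character_re_mem {C : Type*} [CStarAlgebra C] (χ : WeakDual.characterSpace ℂ C) {c : C}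
    {R : ℝ} (hc : ‖c‖ ≤ R) : (χ c).re ∈ Set.Icc (-R) R := by
  have : Nontrivial C := ⟨1, 0, fun h => by
    have h1 : χ (1 : C) = 1 := map_one χ
    rw [h, map_zero] at h1
    exact zero_ne_one h1⟩
  have h1 : ‖χ c‖ ≤ ‖c‖ :=
    spectrum.norm_le_norm_of_mem (WeakDual.CharacterSpace.apply_mem_spectrum χ c)
  exact abs_le.1 ((Complex.abs_re_le_norm _).trans (h1.trans hc))

/-- The map `χ ↦ (χ(a₁), …, χ(aₘ))` from the character space of the C*-algebra generated by the
`aᵢ` to the cube. -/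
def jointCharacter (a : Fin m → A) (R : ℝ) (hR : ∀ i, ‖a i‖ ≤ R) :
    C(WeakDual.characterSpace ℂ (generated a), cube m R) where
  toFun := fun χ => ⟨fun i => (χ ⟨a i, mem_generated a i⟩).re,
    fun i _ => character_re_mem χ (hR i)⟩
  continuous_toFun := by
    refine Continuous.subtype_mk (continuous_pi fun i => ?_) _
    exact Complex.continuous_re.comp
      ((WeakDual.eval_continuous _).comp continuous_subtype_val)

/-- The joint continuous functional calculus `f ↦ f(a₁, …, aₘ)`, `C([-R,R]^m) → A`, of commuting
self-adjoint elements of norm at most `R` of a C*-algebra.  Under the Gelfand isomorphism of the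
commutative C*-algebra generated by the `aᵢ` with the continuous functions on its character
space, `f(a₁, …, aₘ)` corresponds to `χ ↦ f(χ(a₁), …, χ(aₘ))`. -/
def jointCalculus (a : Fin m → A) (hsa : ∀ i, IsSelfAdjoint (a i))
    (hcomm : ∀ i j, Commute (a i) (a j)) (R : ℝ) (hR : ∀ i, ‖a i‖ ≤ R) :
    C(cube m R, ℂ) →⋆ₐ[ℂ] A :=
  letI := generatedCommCStar a hsa hcomm
  (generated a).subtype.comp
    (((gelfandStarTransform (generated a)).symm : _ →⋆ₐ[ℂ] _).comp
      ((jointCharacter a R hR).compStarAlgHom' ℂ ℂ))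

/-- The coordinate function `hᵢ(x) = xᵢ` in `C(X)`. -/
def coord (m : ℕ) (R : ℝ) (i : Fin m) : C(cube m R, ℂ) where
  toFun := fun x => ((x.1 i : ℝ) : ℂ)
  continuous_toFun :=
    Complex.continuous_ofReal.comp ((continuous_apply i).comp continuous_subtype_val)

theorem jointCalculus_coord (a : Fin m → A) (hsa : ∀ i, IsSelfAdjoint (a i))
    (hcomm : ∀ i j, Commute (a i) (a j)) (R : ℝ) (hR : ∀ i, ‖a i‖ ≤ R) (i : Fin m) :
    jointCalculus a hsa hcomm R hR (coord m R i) = a i := by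
  let _ := generatedCommCStar a hsa hcomm
  have h : (coord m R i).comp (jointCharacter a R hR) =
      gelfandStarTransform (generated a) ⟨a i, mem_generated a i⟩ := by
    ext χ
    have hs : IsSelfAdjoint (⟨a i, mem_generated a i⟩ : generated a) := Subtype.ext (hsa i)
    have hχ : star (χ ⟨a i, mem_generated a i⟩) = χ ⟨a i, mem_generated a i⟩ := by
      rw [← map_star, hs.star_eq]
    exact Complex.conj_eq_iff_re.1 hχ
  change (((gelfandStarTransform (generated a)).symm
    ((coord m R i).comp (jointCharacter a R hR)) : generated a) : A) = a i
  rw [h, StarAlgEquiv.symm_apply_apply]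

end JointCalculus

section Chain

/-- Configurations of the infinite chain. -/
abbrev Config (d : ℕ) : Type := ℤ → Fin d

/-- The Hilbert space `ℓ²(Config d)` of square-summable functions of the configuration. -/
abbrev ConfigSpace (d : ℕ) : Type := lp (fun _ : Config d => ℂ) 2

/-- `𝒜_Λ = ⨂_Λ M_d(ℂ)`: matrices indexed by the configurations on `Λ`. -/
abbrev LocalAlg (d : ℕ) (Λ : Finset ℤ) : Type := Matrix (Λ → Fin d) (Λ → Fin d) ℂ

variable {d : ℕ}

/-- The configuration which is `t` on `Λ` and `σ` off `Λ`. -/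
def overwrite (Λ : Finset ℤ) (t : Λ → Fin d) (σ : Config d) : Config d :=
  fun i => if h : i ∈ Λ then t ⟨i, h⟩ else σ i

theorem restrict_overwrite (Λ : Finset ℤ) (t : Λ → Fin d) (σ : Config d) :
    Λ.restrict (overwrite Λ t σ) = t := by
  ext i
  simp [overwrite]

theorem overwrite_overwrite (Λ : Finset ℤ) (s t : Λ → Fin d) (σ : Config d) :
    overwrite Λ s (overwrite Λ t σ) = overwrite Λ s σ := by
  ext i
  by_cases h : i ∈ Λ <;> simp [overwrite, h]

theorem overwrite_restrict (Λ : Finset ℤ) (σ : Config d) :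
    overwrite Λ (Λ.restrict σ) σ = σ := by
  ext i
  by_cases h : i ∈ Λ <;> simp [overwrite, h]

theorem overwrite_eq_self {Λ : Finset ℤ} {s : Λ → Fin d} {σ : Config d}
    (h : Λ.restrict σ = s) : overwrite Λ s σ = σ := by
  rw [← h, overwrite_restrict]

theorem memlp_two_iff {f : Config d → ℂ} : Memℓp f 2 ↔ Summable fun σ => ‖f σ‖ ^ 2 := by
  rw [memℓp_gen_iff (by norm_num)]
  simp

/-- Restricting a square-summable function to `P` after precomposing it with a map injective on
`P` does not increase its norm. -/
theorem sum_comp_le (P : Set (Config d)) [DecidablePred (· ∈ P)] (g : Config d → Config d)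
    (hg : Set.InjOn g P) (ψ : ConfigSpace d) (s : Finset (Config d)) :
    ∑ σ ∈ s, ‖if σ ∈ P then ψ (g σ) else 0‖ ^ 2 ≤ ‖ψ‖ ^ 2 := by
  classical
  have h1 : ∑ σ ∈ s, ‖if σ ∈ P then ψ (g σ) else 0‖ ^ 2 =
      ∑ σ ∈ s.filter (· ∈ P), ‖ψ (g σ)‖ ^ 2 := by
    rw [Finset.sum_filter]
    exact Finset.sum_congr rfl fun σ _ => by split_ifs <;> simp
  have h2 : ∑ σ ∈ s.filter (· ∈ P), ‖ψ (g σ)‖ ^ 2 =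
      ∑ τ ∈ (s.filter (· ∈ P)).image g, ‖ψ τ‖ ^ 2 := by
    rw [Finset.sum_image]
    intro x hx y hy hxy
    exact hg (Finset.mem_filter.1 hx).2 (Finset.mem_filter.1 hy).2 hxy
  rw [h1, h2]
  have := lp.sum_rpow_le_norm_rpow (p := 2) (by norm_num) ψ ((s.filter (· ∈ P)).image g)
  simpa using this

/-- The operator `ψ ↦ 1_P · (ψ ∘ g)` on `ℓ²(Config d)`, for `g` injective on `P`. -/
def compOp (P : Set (Config d)) [DecidablePred (· ∈ P)] (g : Config d → Config d)
    (hg : Set.InjOn g P) : ConfigSpace d →L[ℂ] ConfigSpace d :=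
  LinearMap.mkContinuous
    { toFun := fun ψ => ⟨fun σ => if σ ∈ P then ψ (g σ) else 0, memlp_two_iff.2
        (summable_of_sum_le (fun _ => by positivity) (sum_comp_le P g hg ψ))⟩
      map_add' := by
        intro φ ψ
        ext σ
        change (if σ ∈ P then φ (g σ) + ψ (g σ) else 0) =
          (if σ ∈ P then φ (g σ) else 0) + (if σ ∈ P then ψ (g σ) else 0)
        split_ifs <;> simp
      map_smul' := by
        intro c ψ
        ext σ
        change (if σ ∈ P then c * ψ (g σ) else 0) = c * (if σ ∈ P then ψ (g σ) else 0)
        split_ifs <;> simp } 1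
    (by
      intro ψ
      rw [one_mul]
      refine lp.norm_le_of_forall_sum_le (p := 2) (by norm_num) (norm_nonneg _) fun s => ?_
      have := sum_comp_le P g hg ψ s
      simpa using this)

theorem compOp_apply (P : Set (Config d)) [DecidablePred (· ∈ P)] (g : Config d → Config d)
    (hg : Set.InjOn g P) (ψ : ConfigSpace d) (σ : Config d) :
    compOp P g hg ψ σ = if σ ∈ P then ψ (g σ) else 0 := rfl

theorem overwrite_injOn (Λ : Finset ℤ) (s t : Λ → Fin d) :
    Set.InjOn (overwrite Λ t) {σ : Config d | Λ.restrict σ = s} := by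
  intro σ hσ τ hτ h
  rw [← overwrite_restrict Λ σ, ← overwrite_restrict Λ τ, hσ, hτ,
    ← overwrite_overwrite Λ s t σ, h, overwrite_overwrite]

/-- The matrix unit `e_{st} ∈ 𝒜_Λ` as an operator on `ℓ²(Config d)`. -/
def unitOp (Λ : Finset ℤ) (s t : Λ → Fin d) : ConfigSpace d →L[ℂ] ConfigSpace d :=
  compOp {σ : Config d | Λ.restrict σ = s} (overwrite Λ t) (overwrite_injOn Λ s t)

theorem unitOp_apply (Λ : Finset ℤ) (s t : Λ → Fin d) (ψ : ConfigSpace d) (σ : Config d) :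
    unitOp Λ s t ψ σ = if Λ.restrict σ = s then ψ (overwrite Λ t σ) else 0 := rfl

theorem adjoint_unitOp (Λ : Finset ℤ) (s t : Λ → Fin d) :
    ContinuousLinearMap.adjoint (unitOp Λ s t) = unitOp Λ t s := by
  symm
  rw [ContinuousLinearMap.eq_adjoint_iff]
  intro φ ψ
  rw [lp.inner_eq_tsum, lp.inner_eq_tsum]
  let e : {σ : Config d | Λ.restrict σ = s} ≃ {σ : Config d | Λ.restrict σ = t} :=
    { toFun := fun σ => ⟨overwrite Λ t σ, restrict_overwrite Λ t _⟩
      invFun := fun σ => ⟨overwrite Λ s σ, restrict_overwrite Λ s _⟩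
      left_inv := fun σ => Subtype.ext <| by
        exact (overwrite_overwrite Λ s t σ).trans (overwrite_eq_self σ.2)
      right_inv := fun σ => Subtype.ext <| by
        exact (overwrite_overwrite Λ t s σ).trans (overwrite_eq_self σ.2) }
  have h1 : (fun σ => inner ℂ (unitOp Λ t s φ σ) (ψ σ)) =
      Set.indicator {σ : Config d | Λ.restrict σ = t}
        (fun σ => inner ℂ (φ (overwrite Λ s σ)) (ψ σ)) := by
    ext σ
    rw [unitOp_apply, Set.indicator_apply]
    by_cases h : Λ.restrict σ = t <;> simp [h]
  have h2 : (fun σ => inner ℂ (φ σ) (unitOp Λ s t ψ σ)) =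
      Set.indicator {σ : Config d | Λ.restrict σ = s}
        (fun σ => inner ℂ (φ σ) (ψ (overwrite Λ t σ))) := by
    ext σ
    rw [unitOp_apply, Set.indicator_apply]
    by_cases h : Λ.restrict σ = s <;> simp [h]
  rw [h1, h2, ← tsum_subtype, ← tsum_subtype, ← e.tsum_eq]
  refine tsum_congr fun σ => ?_
  change inner ℂ (φ (overwrite Λ s (overwrite Λ t σ))) (ψ (overwrite Λ t σ)) = _
  rw [(overwrite_overwrite Λ s t σ).trans (overwrite_eq_self σ.2)]

theorem coeFn_finsum {ι : Type*} (S : Finset ι) (f : ι → ConfigSpace d) (σ : Config d) :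
    (∑ i ∈ S, f i) σ = ∑ i ∈ S, f i σ := by
  rw [lp.coeFn_sum, Finset.sum_apply]

/-- The operator on `ℓ²(Config d)` defined by the matrix `M ∈ 𝒜_Λ` acting on the sites of `Λ`,
i.e. `M ⊗ 1`. -/
def localOp (Λ : Finset ℤ) (M : LocalAlg d Λ) : ConfigSpace d →L[ℂ] ConfigSpace d :=
  ∑ s, ∑ t, M s t • unitOp Λ s t

theorem localOp_apply (Λ : Finset ℤ) (M : LocalAlg d Λ) (ψ : ConfigSpace d) (σ : Config d) :
    localOp Λ M ψ σ = ∑ t, M (Λ.restrict σ) t * ψ (overwrite Λ t σ) := by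
  have h : localOp Λ M ψ = ∑ s, ∑ t, M s t • unitOp Λ s t ψ := by
    simp [localOp]
  rw [h, coeFn_finsum, Finset.sum_eq_single (Λ.restrict σ)]
  · rw [coeFn_finsum]
    refine Finset.sum_congr rfl fun t _ => ?_
    rw [lp.coeFn_smul, Pi.smul_apply, unitOp_apply, if_pos rfl, smul_eq_mul]
  · intro s _ hs
    rw [coeFn_finsum]
    refine Finset.sum_eq_zero fun t _ => ?_
    rw [lp.coeFn_smul, Pi.smul_apply, unitOp_apply, if_neg hs.symm, smul_zero]
  · simp

/-- The representation `M ↦ M ⊗ 1` of `𝒜_Λ` on `ℓ²(Config d)`; it is faithful for `d ≥ 1`. -/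
def localRep (d : ℕ) (Λ : Finset ℤ) :
    LocalAlg d Λ →⋆ₐ[ℂ] (ConfigSpace d →L[ℂ] ConfigSpace d) :=
  { AlgHom.ofLinearMap
      { toFun := localOp Λ
        map_add' := by
          intro M N
          ext ψ σ
          change localOp Λ (M + N) ψ σ = localOp Λ M ψ σ + localOp Λ N ψ σ
          simp [localOp_apply, add_mul, Finset.sum_add_distrib]
        map_smul' := by
          intro c M
          ext ψ σ
          change localOp Λ (c • M) ψ σ = c * localOp Λ M ψ σ
          simp [localOp_apply, Finset.mul_sum, mul_assoc] }
      (by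
        ext ψ σ
        change localOp Λ 1 ψ σ = ψ σ
        simp [localOp_apply, Matrix.one_apply, overwrite_restrict])
      (by
        intro M N
        ext ψ σ
        change localOp Λ (M * N) ψ σ = localOp Λ M (localOp Λ N ψ) σ
        simp only [localOp_apply, Matrix.mul_apply, Finset.sum_mul, Finset.mul_sum,
          restrict_overwrite, overwrite_overwrite]
        rw [Finset.sum_comm]
        simp only [mul_assoc]) with
    map_star' := by
      intro M
      change localOp Λ (star M) = ContinuousLinearMap.adjoint (localOp Λ M)
      simp only [localOp, map_sum, map_smulₛₗ, adjoint_unitOp, Matrix.star_apply]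
      rw [Finset.sum_comm]
      rfl }

theorem localRep_apply (Λ : Finset ℤ) (M : LocalAlg d Λ) (ψ : ConfigSpace d) (σ : Config d) :
    localRep d Λ M ψ σ = ∑ t, M (Λ.restrict σ) t * ψ (overwrite Λ t σ) :=
  localOp_apply Λ M ψ σ

theorem localRep_injective [NeZero d] (Λ : Finset ℤ) : Function.Injective (localRep d Λ) := by
  classical
  rw [injective_iff_map_eq_zero]
  intro M hM
  ext s t
  let σ : Config d := overwrite Λ s fun _ => 0
  have h := localRep_apply Λ M (lp.single 2 (overwrite Λ t σ) (1 : ℂ)) σ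
  rw [hM, Finset.sum_eq_single t] at h
  · simpa [σ, restrict_overwrite] using h.symm
  · intro u _ hu
    rw [lp.single_apply_ne, mul_zero]
    intro h'
    have := congrArg (fun τ : Config d => Λ.restrict τ) h'
    simp only [restrict_overwrite] at this
    exact hu this
  · simp

/-- The quasi-local (UHF) C*-algebra `𝒜_ℤ`: the inductive limit of the `𝒜_Λ`, realized as the
C*-algebra generated by all local operators in their (mutually compatible, faithful)
representation on `ℓ²(Config d)`. -/
def quasiLocal (d : ℕ) : StarSubalgebra ℂ (ConfigSpace d →L[ℂ] ConfigSpace d) :=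
  (StarAlgebra.adjoin ℂ (⋃ Λ : Finset ℤ, Set.range (localRep d Λ))).topologicalClosure

theorem localRep_mem (Λ : Finset ℤ) (M : LocalAlg d Λ) : localRep d Λ M ∈ quasiLocal d :=
  StarSubalgebra.le_topologicalClosure _
    (StarAlgebra.subset_adjoin ℂ _ (Set.mem_iUnion.2 ⟨Λ, M, rfl⟩))

/-- The embedding `𝒜_Λ ⊆ 𝒜_ℤ`. -/
def incl (d : ℕ) (Λ : Finset ℤ) : LocalAlg d Λ →⋆ₐ[ℂ] quasiLocal d :=
  (localRep d Λ).codRestrict (quasiLocal d) (localRep_mem Λ)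

/-- The configuration shifted by `j`. -/
def shiftConfig (j : ℤ) (σ : Config d) : Config d := fun i => σ (i + j)

theorem shiftConfig_injective (j : ℤ) : Function.Injective (shiftConfig (d := d) j) := by
  intro σ τ h
  ext i
  have := congrFun h (i - j)
  simp only [shiftConfig, sub_add_cancel] at this
  rw [this]

/-- The shift `(U_j ψ)(σ) = ψ(σ(· + j))` as a bounded operator. -/
def shiftOp (d : ℕ) (j : ℤ) : ConfigSpace d →L[ℂ] ConfigSpace d :=
  compOp Set.univ (shiftConfig j) ((shiftConfig_injective j).injOn)

theorem shiftOp_apply (j : ℤ) (ψ : ConfigSpace d) (σ : Config d) :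
    shiftOp d j ψ σ = ψ (shiftConfig j σ) := by
  simp [shiftOp, compOp_apply]

theorem norm_shiftOp_le (j : ℤ) (ψ : ConfigSpace d) : ‖shiftOp d j ψ‖ ≤ ‖ψ‖ := by
  classical
  refine lp.norm_le_of_forall_sum_le (p := 2) (by norm_num) (norm_nonneg _) fun s => ?_
  have := sum_comp_le Set.univ (shiftConfig j) ((shiftConfig_injective j).injOn) ψ s
  simpa [shiftOp_apply] using this

theorem shiftOp_shiftOp (j k : ℤ) (h : j + k = 0) (ψ : ConfigSpace d) :
    shiftOp d j (shiftOp d k ψ) = ψ := by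
  ext σ
  rw [shiftOp_apply, shiftOp_apply]
  have h' : k + j = 0 := by omega
  refine congrArg (fun τ => ψ τ) (funext fun i => ?_)
  simp [shiftConfig, add_assoc, h']

/-- The unitary `(U_j ψ)(σ) = ψ(σ(· + j))`, which implements the translation by `j` sites. -/
def shiftUnitary (d : ℕ) (j : ℤ) : ConfigSpace d ≃ₗᵢ[ℂ] ConfigSpace d where
  toFun := shiftOp d j
  map_add' := map_add _
  map_smul' := map_smul _
  invFun := shiftOp d (-j)
  left_inv := shiftOp_shiftOp _ _ (by simp)
  right_inv := shiftOp_shiftOp _ _ (by simp)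
  norm_map' ψ := by
    refine le_antisymm (norm_shiftOp_le j ψ) ?_
    have h := norm_shiftOp_le (-j) (shiftOp d j ψ)
    rwa [shiftOp_shiftOp _ _ (by simp)] at h

/-- The matrix `M ∈ 𝒜_Λ` moved to the sites `Λ + j`. -/
def shiftMatrix (Λ : Finset ℤ) (j : ℤ) (M : LocalAlg d Λ) :
    LocalAlg d (Λ.map (addRightEmbedding j)) :=
  M.submatrix (fun s i => s ⟨i.1 + j, Finset.mem_map_of_mem (addRightEmbedding j) i.2⟩)
    (fun s i => s ⟨i.1 + j, Finset.mem_map_of_mem (addRightEmbedding j) i.2⟩)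

theorem sub_mem_of_mem_map {Λ : Finset ℤ} {j i : ℤ} (h : i ∈ Λ.map (addRightEmbedding j)) :
    i - j ∈ Λ := by
  obtain ⟨l, hl, rfl⟩ := Finset.mem_map.1 h
  simpa using hl

theorem conj_localRep (Λ : Finset ℤ) (j : ℤ) (M : LocalAlg d Λ) :
    (shiftUnitary d j).conjStarAlgEquiv (localRep d Λ M) =
      localRep d (Λ.map (addRightEmbedding j)) (shiftMatrix Λ j M) := by
  ext ψ σ
  change shiftOp d j (localRep d Λ M (shiftOp d (-j) ψ)) σ = _
  rw [shiftOp_apply, localRep_apply, localRep_apply]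
  let e : (Λ → Fin d) ≃ (Λ.map (addRightEmbedding j) → Fin d) :=
    { toFun := fun t i => t ⟨i.1 - j, sub_mem_of_mem_map i.2⟩
      invFun := fun t i => t ⟨i.1 + j, Finset.mem_map_of_mem (addRightEmbedding j) i.2⟩
      left_inv := fun t => by ext i; simp
      right_inv := fun t => by ext i; simp }
  rw [← e.sum_comp]
  refine Finset.sum_congr rfl fun t _ => ?_
  rw [shiftOp_apply]
  have h1 : shiftMatrix Λ j M (Finset.restrict _ σ) (e t) =
      M (Λ.restrict (shiftConfig j σ)) t := by
    change M _ (e.symm (e t)) = _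
    rw [e.symm_apply_apply]
    rfl
  have h2 : shiftConfig (-j) (overwrite Λ t (shiftConfig j σ)) =
      overwrite (Λ.map (addRightEmbedding j)) (e t) σ := by
    ext i
    by_cases h : i ∈ Λ.map (addRightEmbedding j)
    · have h' := sub_mem_of_mem_map h
      simp only [shiftConfig, overwrite, ← sub_eq_add_neg, h, h', dif_pos, e, Equiv.coe_fn_mk]
    · have h' : i - j ∉ Λ := fun h' => h (Finset.mem_map.2 ⟨i - j, h', by simp⟩)
      simp only [shiftConfig, overwrite, ← sub_eq_add_neg, h, h', dif_neg, not_false_eq_true,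
        sub_add_cancel]
  rw [h1, h2]

theorem conj_mem_quasiLocal (j : ℤ) {T : ConfigSpace d →L[ℂ] ConfigSpace d}
    (hT : T ∈ quasiLocal d) : (shiftUnitary d j).conjStarAlgEquiv T ∈ quasiLocal d := by
  let Φ : (ConfigSpace d →L[ℂ] ConfigSpace d) →⋆ₐ[ℂ] (ConfigSpace d →L[ℂ] ConfigSpace d) :=
    (shiftUnitary d j).conjStarAlgEquiv
  have hΦ : Continuous Φ := by
    change Continuous fun T => (shiftUnitary d j).conjStarAlgEquiv T
    simp only [LinearIsometryEquiv.conjStarAlgEquiv_apply]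
    fun_prop
  have hle : StarAlgebra.adjoin ℂ (⋃ Λ : Finset ℤ, Set.range (localRep d Λ)) ≤
      (quasiLocal d).comap Φ := by
    refine StarAlgebra.adjoin_le ?_
    intro S hS
    obtain ⟨Λ, M, rfl⟩ := Set.mem_iUnion.1 hS
    change (shiftUnitary d j).conjStarAlgEquiv (localRep d Λ M) ∈ quasiLocal d
    rw [conj_localRep]
    exact localRep_mem _ _
  have hcl : IsClosed ((quasiLocal d).comap Φ : Set (ConfigSpace d →L[ℂ] ConfigSpace d)) :=
    (StarSubalgebra.isClosed_topologicalClosure _).preimage hΦ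
  exact StarSubalgebra.topologicalClosure_minimal hle hcl hT

/-- The lattice translation `γ_j` of `𝒜_ℤ`. -/
def translation (d : ℕ) (j : ℤ) : quasiLocal d →⋆ₐ[ℂ] quasiLocal d :=
  (((shiftUnitary d j).conjStarAlgEquiv :
      (ConfigSpace d →L[ℂ] ConfigSpace d) →⋆ₐ[ℂ] (ConfigSpace d →L[ℂ] ConfigSpace d)).comp
    (quasiLocal d).subtype).codRestrict (quasiLocal d) fun T => conj_mem_quasiLocal j T.2

/-- The embedding of `M_d(ℂ)` into `𝒜_Λ` as the algebra of the site `j ∈ Λ`. -/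
def siteMatrix (Λ : Finset ℤ) (j : Λ) (A : Matrix (Fin d) (Fin d) ℂ) : LocalAlg d Λ :=
  Matrix.of fun s t => if ∀ k, k ≠ j → s k = t k then A (s j) (t j) else 0

theorem siteMatrix_apply (Λ : Finset ℤ) (j : Λ) (A : Matrix (Fin d) (Fin d) ℂ)
    (s t : Λ → Fin d) :
    siteMatrix Λ j A s t = if ∀ k, k ≠ j → s k = t k then A (s j) (t j) else 0 := rfl

theorem sum_siteMatrix (Λ : Finset ℤ) (j : Λ) (A : Matrix (Fin d) (Fin d) ℂ)
    (s : Λ → Fin d) (f : (Λ → Fin d) → ℂ) :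
    ∑ t, siteMatrix Λ j A s t * f t = ∑ a, A (s j) a * f (Function.update s j a) := by
  symm
  refine Fintype.sum_of_injective (fun a => Function.update s j a)
    (Function.update_injective s j) _ _ ?_ ?_
  · intro t ht
    rw [siteMatrix_apply, if_neg, zero_mul]
    intro h
    refine ht ⟨t j, funext fun k => ?_⟩
    by_cases hk : k = j
    · subst hk; simp
    · simp [hk, h k hk]
  · intro a
    rw [siteMatrix_apply, if_pos]
    · simp
    · intro k hk
      simp [hk]

/-- `siteMatrix` as a `*`-homomorphism. -/
def siteEmb (d : ℕ) (Λ : Finset ℤ) (j : Λ) :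
    Matrix (Fin d) (Fin d) ℂ →⋆ₐ[ℂ] LocalAlg d Λ :=
  { AlgHom.ofLinearMap
      { toFun := siteMatrix Λ j
        map_add' := by
          intro A B
          ext s t
          simp only [siteMatrix_apply, Matrix.add_apply]
          split_ifs <;> simp
        map_smul' := by
          intro c A
          ext s t
          simp only [siteMatrix_apply, Matrix.smul_apply, RingHom.id_apply]
          split_ifs <;> simp }
      (by
        ext s t
        change siteMatrix Λ j 1 s t = _
        simp only [siteMatrix_apply, Matrix.one_apply]
        by_cases h : s = t
        · simp [h]
        · rw [if_neg h]
          split_ifs with h1 h2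
          · exact absurd (funext fun k => if hk : k = j then hk ▸ h2 else h1 k hk) h
          · rfl
          · rfl)
      (by
        intro A B
        ext s t
        change siteMatrix Λ j (A * B) s t = (siteMatrix Λ j A * siteMatrix Λ j B) s t
        rw [Matrix.mul_apply, sum_siteMatrix]
        have h : ∀ a, (∀ k, k ≠ j → Function.update s j a k = t k) ↔
            (∀ k, k ≠ j → s k = t k) := fun a =>
          forall_congr' fun k => imp_congr_right fun hk => by simp [hk]
        simp only [siteMatrix_apply, h, Matrix.mul_apply, Function.update_self]
        split_ifs <;> simp) with
    map_star' := by
      intro A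
      ext s t
      change siteMatrix Λ j (star A) s t = star (siteMatrix Λ j A t s)
      simp only [siteMatrix_apply, Matrix.star_apply]
      by_cases h : ∀ k, k ≠ j → s k = t k
      · rw [if_pos h, if_pos fun k hk => (h k hk).symm]
      · rw [if_neg h, if_neg fun h' => h fun k hk => (h' k hk).symm, star_zero] }

theorem siteEmb_apply (Λ : Finset ℤ) (j : Λ) (A : Matrix (Fin d) (Fin d) ℂ) (s t : Λ → Fin d) :
    siteEmb d Λ j A s t = if ∀ k, k ≠ j → s k = t k then A (s j) (t j) else 0 := rfl

theorem siteEmb_commute (Λ : Finset ℤ) {j k : Λ} (hjk : j ≠ k)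
    (A B : Matrix (Fin d) (Fin d) ℂ) : Commute (siteEmb d Λ j A) (siteEmb d Λ k B) := by
  have key : ∀ {j k : Λ}, j ≠ k → ∀ A B : Matrix (Fin d) (Fin d) ℂ, ∀ s t,
      (siteEmb d Λ j A * siteEmb d Λ k B) s t =
        if ∀ l, l ≠ j → l ≠ k → s l = t l then A (s j) (t j) * B (s k) (t k) else 0 := by
    intro j k hjk A B s t
    rw [Matrix.mul_apply]
    refine (sum_siteMatrix Λ j A s fun u => siteEmb d Λ k B u t).trans ?_
    rw [Finset.sum_eq_single (t j)]
    · rw [siteEmb_apply]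
      have h : (∀ l, l ≠ k → Function.update s j (t j) l = t l) ↔
          (∀ l, l ≠ j → l ≠ k → s l = t l) := by
        refine forall_congr' fun l => ?_
        by_cases hl : l = j
        · subst hl; simp
        · simp [hl]
      simp only [h, Function.update_of_ne hjk.symm]
      split_ifs <;> simp
    · intro a _ ha
      rw [siteEmb_apply, if_neg, mul_zero]
      intro h
      exact ha (by simpa using h j hjk)
    · simp
  ext s t
  rw [key hjk, key hjk.symm]
  have h : (∀ l, l ≠ j → l ≠ k → s l = t l) ↔ (∀ l, l ≠ k → l ≠ j → s l = t l) :=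
    ⟨fun h l h1 h2 => h l h2 h1, fun h l h1 h2 => h l h2 h1⟩
  simp only [h, mul_comm]

/-- The interval `[-n, n]` of the chain. -/
def window (n : ℕ) : Finset ℤ := Finset.Icc (-(n : ℤ)) n

theorem card_window (n : ℕ) : Fintype.card (window n) = 2 * n + 1 := by
  rw [Fintype.card_coe, window, Int.card_Icc]
  omega

/-- The macroscopic observable `(2n+1)⁻¹ ∑_{j=-n}^{n} γ_j(A)`, as an element of `𝒜_{[-n,n]}`. -/
def meanObs (n : ℕ) (A : Matrix (Fin d) (Fin d) ℂ) : LocalAlg d (window n) :=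
  ((2 * n + 1 : ℝ)⁻¹ : ℂ) • ∑ j, siteEmb d (window n) j A

/-- The one-site observable `A` at the site `0`, as an element of `𝒜_ℤ`. -/
def oneSite (A : Matrix (Fin d) (Fin d) ℂ) : quasiLocal d :=
  incl d {0} (siteEmb d {0} ⟨0, Finset.mem_singleton_self 0⟩ A)

theorem localRep_siteEmb (Λ : Finset ℤ) (j : Λ) (A : Matrix (Fin d) (Fin d) ℂ)
    (ψ : ConfigSpace d) (σ : Config d) :
    localRep d Λ (siteEmb d Λ j A) ψ σ =
      ∑ a, A (σ j) a * ψ (Function.update σ (j : ℤ) a) := by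
  rw [localRep_apply]
  refine (sum_siteMatrix Λ j A (Λ.restrict σ) fun t => ψ (overwrite Λ t σ)).trans ?_
  refine Finset.sum_congr rfl fun a _ => ?_
  have h : overwrite Λ (Function.update (Λ.restrict σ) j a) σ =
      Function.update σ (j : ℤ) a := by
    funext i
    by_cases hi : i ∈ Λ
    · by_cases hij : i = j
      · subst hij
        simp [overwrite]
      · have : (⟨i, hi⟩ : Λ) ≠ j := fun h => hij (congrArg Subtype.val h)
        simp [overwrite, hi, hij, this]
    · have : i ≠ j := fun h => hi (h ▸ j.2)
      simp [overwrite, hi, this]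
  rw [h]
  rfl

/-- In `𝒜_ℤ`, the element `meanObs n A` is the spatial mean of the translates of `A`. -/
theorem incl_meanObs (n : ℕ) (A : Matrix (Fin d) (Fin d) ℂ) :
    incl d (window n) (meanObs n A) =
      ((2 * n + 1 : ℝ)⁻¹ : ℂ) • ∑ j ∈ window n, translation d j (oneSite A) := by
  rw [meanObs, map_smul, map_sum, ← Finset.sum_coe_sort (window n)]
  congr 1
  refine Finset.sum_congr rfl fun j _ => Subtype.ext ?_
  change localRep d (window n) (siteEmb d (window n) j A) =
    (shiftUnitary d j).conjStarAlgEquiv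
      (localRep d {0} (siteEmb d {0} ⟨0, Finset.mem_singleton_self 0⟩ A))
  ext ψ σ
  change _ = shiftOp d j (localRep d {0} _ (shiftOp d (-j) ψ)) σ
  rw [shiftOp_apply, localRep_siteEmb, localRep_siteEmb]
  refine Finset.sum_congr rfl fun a _ => ?_
  rw [shiftOp_apply]
  have h : shiftConfig (-(j : ℤ)) (Function.update (shiftConfig (j : ℤ) σ) 0 a) =
      Function.update σ (j : ℤ) a := by
    funext i
    by_cases hi : i = j
    · subst hi; simp [shiftConfig]
    · have : i + -(j : ℤ) ≠ 0 := fun h => hi (by omega)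
      simp [shiftConfig, hi, this]
  rw [h]
  simp [shiftConfig]

end Chain

section States

variable {d m : ℕ}

open scoped ComplexOrder in
/-- `ω` is a translation invariant state of `𝒜_ℤ`: a positive normalized linear functional
(hence bounded) with `ω ∘ γ_j = ω` for all `j ∈ ℤ`. -/
structure IsInvariantState (ω : quasiLocal d →ₗ[ℂ] ℂ) : Prop where
  nonneg : ∀ a, 0 ≤ ω (star a * a)
  map_one : ω 1 = 1
  invariant : ∀ j a, ω (translation d j a) = ω a

/-- The density matrix `ρ` of the restriction of `ω` to `𝒜_{[-n,n]}`: `ω(M) = Tr(ρ M)`. -/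
def densityMatrix (ω : quasiLocal d →ₗ[ℂ] ℂ) (n : ℕ) : LocalAlg d (window n) :=
  Matrix.of fun s t => ω (incl d (window n) (Matrix.single t s 1))

theorem trace_densityMatrix_mul (ω : quasiLocal d →ₗ[ℂ] ℂ) (n : ℕ) (M : LocalAlg d (window n)) :
    (densityMatrix ω n * M).trace = ω (incl d (window n) M) := by
  conv_rhs => rw [Matrix.matrix_eq_sum_single M]
  simp only [map_sum, Matrix.trace, Matrix.diag, Matrix.mul_apply, densityMatrix, Matrix.of_apply]
  rw [Finset.sum_comm]
  refine Finset.sum_congr rfl fun s _ => Finset.sum_congr rfl fun t _ => ?_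
  have h : Matrix.single s t (M s t) = M s t • Matrix.single s t (1 : ℂ) := by
    rw [Matrix.smul_single, smul_eq_mul, mul_one]
  rw [h, map_smul, map_smul, smul_eq_mul, mul_comm]

/-- The von Neumann entropy `S_{[-n,n]}(ω) = -Tr(ρ log ρ)`. -/
def localEntropy (ω : quasiLocal d →ₗ[ℂ] ℂ) (n : ℕ) : ℝ :=
  (cfc Real.negMulLog (densityMatrix ω n)).trace.re

/-- The mean entropy `s(ω) = lim (2n+1)⁻¹ S_{[-n,n]}(ω)`.  For a translation invariant state the
limit exists, so it equals the upper limit. -/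
def meanEntropy (ω : quasiLocal d →ₗ[ℂ] ℂ) : EReal :=
  limsup (fun n : ℕ => ((localEntropy ω n / (2 * n + 1) : ℝ) : EReal)) atTop

/-- The entropy function `μ(x)`: the supremum of `s(ω)` over all translation invariant states `ω`
with `ω(A_i) = x_i` for all `i` (the supremum of the empty set in `EReal` is `-∞`). -/
def entropyFn (A : Fin m → Matrix (Fin d) (Fin d) ℂ) (x : Fin m → ℝ) : EReal :=
  sSup {s | ∃ ω : quasiLocal d →ₗ[ℂ] ℂ, IsInvariantState ω ∧
    (∀ i, ω (oneSite (A i)) = (x i : ℂ)) ∧ s = meanEntropy ω}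

/-- `dom μ = {x : μ(x) > -∞}`. -/
def entropyDom (A : Fin m → Matrix (Fin d) (Fin d) ℂ) : Set (Fin m → ℝ) :=
  {x | ⊥ < entropyFn A x}

end States

section Observables

variable {d m : ℕ}

theorem norm_siteEmb_le (Λ : Finset ℤ) (j : Λ) (A : Matrix (Fin d) (Fin d) ℂ) :
    ‖siteEmb d Λ j A‖ ≤ ‖A‖ :=
  NonUnitalStarAlgHom.norm_apply_le (siteEmb d Λ j) A

theorem norm_meanObs_le (n : ℕ) (A : Matrix (Fin d) (Fin d) ℂ) : ‖meanObs n A‖ ≤ ‖A‖ := by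
  have hpos : (0 : ℝ) < 2 * n + 1 := by positivity
  have h : ‖∑ j, siteEmb d (window n) j A‖ ≤ (2 * n + 1 : ℝ) * ‖A‖ := by
    refine (norm_sum_le _ _).trans ((Finset.sum_le_sum fun j _ =>
      norm_siteEmb_le (window n) j A).trans ?_)
    rw [Finset.sum_const, Finset.card_univ, card_window, nsmul_eq_mul]
    push_cast
    exact le_rfl
  have h1 : ‖((2 * n + 1 : ℝ)⁻¹ : ℂ)‖ = (2 * n + 1 : ℝ)⁻¹ := by
    rw [← Complex.ofReal_inv, Complex.norm_real, Real.norm_of_nonneg (by positivity)]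
  rw [meanObs, norm_smul, h1, inv_mul_le_iff₀ hpos]
  exact h

theorem isSelfAdjoint_meanObs (n : ℕ) {A : Matrix (Fin d) (Fin d) ℂ} (hA : A.IsHermitian) :
    IsSelfAdjoint (meanObs n A) := by
  have h1 : IsSelfAdjoint A := hA
  refine IsSelfAdjoint.smul ?_ ?_
  · rw [← Complex.ofReal_inv]
    exact Complex.conj_ofReal _
  · exact isSelfAdjoint_sum _ fun j _ => h1.map (siteEmb d (window n) j)

theorem meanObs_commutator (n : ℕ) (A B : Matrix (Fin d) (Fin d) ℂ) :
    meanObs n A * meanObs n B - meanObs n B * meanObs n A =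
      ((2 * n + 1 : ℝ)⁻¹ : ℂ) • meanObs n (A * B - B * A) := by
  have h : (∑ j, siteEmb d (window n) j A) * (∑ j, siteEmb d (window n) j B) -
      (∑ j, siteEmb d (window n) j B) * (∑ j, siteEmb d (window n) j A) =
      ∑ j, siteEmb d (window n) j (A * B - B * A) := by
    rw [Finset.sum_mul_sum, Finset.sum_mul_sum]
    conv_lhs => rw [Finset.sum_comm]
    rw [← Finset.sum_sub_distrib]
    refine Finset.sum_congr rfl fun j _ => ?_
    rw [← Finset.sum_sub_distrib, Finset.sum_eq_single j]
    · rw [map_sub, map_mul, map_mul]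
    · intro k _ hk
      rw [(siteEmb_commute (window n) hk A B).eq, sub_self]
    · simp
  simp only [meanObs, smul_mul_assoc, mul_smul_comm]
  rw [← smul_sub, ← smul_sub, h]

theorem tendsto_commutator (A B : Matrix (Fin d) (Fin d) ℂ) :
    Tendsto (fun n : ℕ => ‖meanObs n A * meanObs n B - meanObs n B * meanObs n A‖)
      atTop (𝓝 0) := by
  have h : Tendsto (fun n : ℕ => (2 * (n : ℝ) + 1)⁻¹ * ‖A * B - B * A‖) atTop (𝓝 0) := by
    have h1 : Tendsto (fun n : ℕ => 2 * (n : ℝ) + 1) atTop atTop :=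
      tendsto_atTop_add_const_right _ _
        (tendsto_natCast_atTop_atTop.const_mul_atTop (by norm_num))
    simpa using h1.inv_tendsto_atTop.mul_const ‖A * B - B * A‖
  refine squeeze_zero (fun n => norm_nonneg _) (fun n => ?_) h
  have h1 : ‖((2 * n + 1 : ℝ)⁻¹ : ℂ)‖ = (2 * n + 1 : ℝ)⁻¹ := by
    rw [← Complex.ofReal_inv, Complex.norm_real, Real.norm_of_nonneg (by positivity)]
  rw [meanObs_commutator, norm_smul, h1]
  exact mul_le_mul_of_nonneg_left (norm_meanObs_le n _) (by positivity)

variable [NeZero d]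

/-- The algebras `M_{n_k} = 𝒜_{[-n_k, n_k]}`. -/
abbrev WindowAlg (d : ℕ) (n : ℕ → ℕ) (k : ℕ) : Type := LocalAlg d (window (n k))

/-- The bounded sequence `(H_{n_k})_k ∈ B`. -/
def obsSeq (n : ℕ → ℕ) (A : Matrix (Fin d) (Fin d) ℂ) : BddSeq (WindowAlg d n) :=
  ⟨fun k => meanObs (n k) A, memℓp_infty ⟨‖A‖, by
    rintro _ ⟨k, rfl⟩
    exact norm_meanObs_le (n k) A⟩⟩

/-- The element `π((H_{n_k})_k)` of `A = B / D`. -/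
def obs (n : ℕ → ℕ) (A : Matrix (Fin d) (Fin d) ℂ) : SeqQuot (WindowAlg d n) :=
  SeqQuot.proj (WindowAlg d n) (obsSeq n A)

theorem norm_obs_le (n : ℕ → ℕ) (A : Matrix (Fin d) (Fin d) ℂ) : ‖obs n A‖ ≤ ‖A‖ :=
  SeqQuot.norm_mkₐ_le_of_eventually (norm_nonneg _)
    (Eventually.of_forall fun k => norm_meanObs_le (n k) A)

theorem isSelfAdjoint_obs (n : ℕ → ℕ) {A : Matrix (Fin d) (Fin d) ℂ} (hA : A.IsHermitian) :
    IsSelfAdjoint (obs n A) := by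
  refine IsSelfAdjoint.map ?_ (SeqQuot.proj (WindowAlg d n))
  refine lp.ext (funext fun k => ?_)
  exact isSelfAdjoint_meanObs (n k) hA

theorem obs_commute {n : ℕ → ℕ} (hn : StrictMono n) (A B : Matrix (Fin d) (Fin d) ℂ) :
    Commute (obs n A) (obs n B) := by
  have h : SeqQuot.mkₐ _ (obsSeq n A * obsSeq n B) = SeqQuot.mkₐ _ (obsSeq n B * obsSeq n A) := by
    rw [SeqQuot.mkₐ_eq_iff, mem_nullIdeal]
    exact (tendsto_commutator A B).comp hn.tendsto_atTop
  rw [map_mul, map_mul] at h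
  exact h

/-- The `*`-homomorphism `φ : C(X) → A`, `φ(f) = f(π((H_{1,n_k})), …, π((H_{m,n_k})))`. -/
def obsCalculus (A : Fin m → Matrix (Fin d) (Fin d) ℂ) (hA : ∀ i, (A i).IsHermitian)
    (n : ℕ → ℕ) (hn : StrictMono n) (R : ℝ) (hR : ∀ i, ‖A i‖ < R) :
    C(cube m R, ℂ) →⋆ₐ[ℂ] SeqQuot (WindowAlg d n) :=
  jointCalculus (fun i => obs n (A i)) (fun i => isSelfAdjoint_obs n (hA i))
    (fun i j => obs_commute hn (A i) (A j)) R (fun i => (norm_obs_le n (A i)).trans (hR i).le)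

theorem obsCalculus_coord (A : Fin m → Matrix (Fin d) (Fin d) ℂ) (hA : ∀ i, (A i).IsHermitian)
    (n : ℕ → ℕ) (hn : StrictMono n) (R : ℝ) (hR : ∀ i, ‖A i‖ < R) (i : Fin m) :
    obsCalculus A hA n hn R hR (coord m R i) = obs n (A i) :=
  jointCalculus_coord _ _ _ R _ i

/-- The set `S`: those `x ∈ X` such that every neighbourhood `U` of `x` in `X` contains the support
of some `f ∈ C(X)` with `φ(f) ≠ 0`. -/
def jointSpectrum (A : Fin m → Matrix (Fin d) (Fin d) ℂ) (hA : ∀ i, (A i).IsHermitian)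
    (n : ℕ → ℕ) (hn : StrictMono n) (R : ℝ) (hR : ∀ i, ‖A i‖ < R) : Set (Fin m → ℝ) :=
  {x | ∃ hx : x ∈ cube m R, ∀ U ∈ 𝓝 (⟨x, hx⟩ : cube m R),
    ∃ f : C(cube m R, ℂ), tsupport f ⊆ U ∧ obsCalculus A hA n hn R hR f ≠ 0}

end Observables

end SpinChain
end

/-! Both sets consist of the joint values (χ(a_1), …, χ(a_m)) of the characters χ of the commutative
C*-algebra generated by the macroscopic observables a_i = `obs n (A i)`. For S this is Gelfand
theory: φ kills f exactly when f vanishes on the compact set of joint values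
(`mem_jointSpectrum_iff`). For dom μ, the mean entropy of an invariant state is nonnegative, so μ(x)
> -∞ only says that some invariant state has expectations x (`mem_entropyDom_iff`). It remains to
pass between invariant states and characters.

From a character to a state (`exists_invariantState_of_character`): extend χ by Hahn-Banach to a
contractive functional on A and evaluate it at the class of the sequence of spatial means of an
operator over [-n_k, n_k]. The mean of a general operator need not lie in 𝒜_{n_k}, so it is
compressed into it. A shift changes the mean only by boundary terms, which vanish in the quotient.
The resulting functional is contractive and unital, hence positive, and it is translation invariant.

From a state to a character (`exists_character_of_invariantState`): only the one-site density matrix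
ρ of the state matters. In ρ ⊗ … ⊗ ρ the variance of the spatial mean of A_i is of order 1/n, which
yields nonzero vectors almost annihilated by all H_{i,n} - x_i at once. If x were not a joint value,
∑ (a_i - x_i)² would be invertible, and a lift of its inverse to a bounded sequence would contradict
these vectors (`mem_range_jointCharacter_of_density`). -/

noncomputable section
namespace SpinChain

/-! ### Positivity of contractive unital functionals. -/

section CStar

/-- A contractive unital linear functional on a C*-algebra is positive. -/
theorem nonneg_of_contractive_unital {C : Type*} [CStarAlgebra C] (ω : C →ₗ[ℂ] ℂ)
    (hn : ∀ a, ‖ω a‖ ≤ ‖a‖) (h1 : ω 1 = 1) (a : C) :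
    0 ≤ (ω (star a * a)).re ∧ (ω (star a * a)).im = 0 := by
  have : Nontrivial C := by
    by_contra h
    rw [not_nontrivial_iff_subsingleton] at h
    exact one_ne_zero (h1.symm.trans ((congrArg ω (Subsingleton.elim 1 0)).trans (map_zero ω)))
  set b := star a * a with hb
  have hbs : IsSelfAdjoint b := IsSelfAdjoint.star_mul_self a
  -- The spectrum of b lies in [0, ‖b‖]; subtracting the midpoint r leaves a self-adjoint e with ‖e‖
  -- ≤ r.
  set r : ℝ := ‖b‖ / 2 with hr
  have hr0 : 0 ≤ r := by positivity
  set e : C := b - (r : ℂ) • (1 : C) with he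
  have hes : IsSelfAdjoint e := by
    refine hbs.sub (IsSelfAdjoint.smul ?_ (IsSelfAdjoint.one C))
    exact Complex.conj_ofReal _
  have hen : ‖e‖ ≤ r := by
    have h2 : e = cfc (fun x : ℝ => x - r) b := by
      rw [cfc_sub (fun x : ℝ => x) (fun _ => r) b, cfc_id' ℝ b, cfc_const r b, he,
        Algebra.algebraMap_eq_smul_one, Complex.coe_smul]
    rw [h2]
    refine norm_cfc_le hr0 fun x hx => ?_
    have hx0 : 0 ≤ x := spectrum_star_mul_self_nonneg x hx
    have hx1 : ‖x‖ ≤ ‖b‖ := spectrum.norm_le_norm_of_mem hx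
    rw [Real.norm_eq_abs, abs_of_nonneg hx0] at hx1
    rw [Real.norm_eq_abs, abs_le]
    constructor <;> linarith
  clear_value e
  -- Contractivity is tested on e - it, whose squared norm is at most r² + t² by the C*-identity.
  have key : ∀ t : ℝ, ((ω e).re) ^ 2 + ((ω e).im - t) ^ 2 ≤ r ^ 2 + t ^ 2 := by
    intro t
    have h3 : ‖e - ((t : ℂ) * Complex.I) • (1 : C)‖ ^ 2 ≤ r ^ 2 + t ^ 2 := by
      have h4 : star (e - ((t : ℂ) * Complex.I) • (1 : C)) * (e - ((t : ℂ) * Complex.I) • (1 : C)) =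
          e * e + ((t ^ 2 : ℝ) : ℂ) • (1 : C) := by
        rw [star_sub, hes.star_eq, star_smul, star_one]
        have : star ((t : ℂ) * Complex.I) = -((t : ℂ) * Complex.I) := by simp
        rw [this]
        simp only [neg_smul, sub_neg_eq_add, add_mul, mul_sub, smul_mul_assoc, mul_smul_comm,
          one_mul, mul_one]
        have h5 : (t : ℂ) * Complex.I * ((t : ℂ) * Complex.I) = -((t ^ 2 : ℝ) : ℂ) := by
          push_cast
          linear_combination (t : ℂ) ^ 2 * Complex.I_sq
        rw [smul_add, smul_smul, h5, neg_smul]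
        abel
      rw [sq, ← CStarRing.norm_star_mul_self, h4]
      refine (norm_add_le _ _).trans (add_le_add ?_ ?_)
      · rw [sq]
        exact (norm_mul_le _ _).trans (mul_le_mul hen hen (norm_nonneg _) hr0)
      · rw [norm_smul, Complex.norm_real, Real.norm_of_nonneg (sq_nonneg t)]
        refine mul_le_of_le_one_right (sq_nonneg t) ?_
        exact CStarRing.norm_one.le
    have h6 := hn (e - ((t : ℂ) * Complex.I) • (1 : C))
    rw [map_sub, map_smul, h1] at h6
    have h7 : ‖ω e - ((t : ℂ) * Complex.I) • (1 : ℂ)‖ ^ 2 =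
        ((ω e).re) ^ 2 + ((ω e).im - t) ^ 2 := by
      rw [← Complex.normSq_eq_norm_sq, Complex.normSq_apply]
      simp
      ring
    rw [← h7]
    exact (pow_le_pow_left₀ (norm_nonneg _) h6 2).trans h3
  have him : (ω e).im = 0 := by
    by_contra hne
    -- For this t the cross term -2t · Im ω(e) equals 2r², so `key` would give (Re ω(e))² + (Im
    -- ω(e))² + r² ≤ 0.
    have h8 := key (-(r ^ 2 / (ω e).im))
    have h9 : ((ω e).im - -(r ^ 2 / (ω e).im)) ^ 2 =
        (ω e).im ^ 2 + 2 * r ^ 2 + (-(r ^ 2 / (ω e).im)) ^ 2 := by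
      field_simp
      ring
    have h10 : 0 < (ω e).im ^ 2 := by positivity
    nlinarith [sq_nonneg (ω e).re, sq_nonneg r]
  have hre : |(ω e).re| ≤ r := by
    have := key 0
    rw [him] at this
    exact abs_le_of_sq_le_sq (by linarith) hr0
  have hω : ω b = ω e + r := by
    rw [he, map_sub, map_smul, h1]
    simp
  rw [hω]
  constructor
  · have := (abs_le.1 hre).1
    simp
    linarith
  · simp [him]

end CStar

/-! ### The support of the joint calculus and characters. -/

section JointSpectrum

variable {A : Type*} [CStarAlgebra A] {m : ℕ}

/-- By construction the calculus is f ↦ f ∘ `jointCharacter` followed by the inverse Gelfand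
transform and an inclusion, and the last two maps are injective. -/
theorem jointCalculus_eq_zero_iff (a : Fin m → A) (hsa : ∀ i, IsSelfAdjoint (a i))
    (hcomm : ∀ i j, Commute (a i) (a j)) (R : ℝ) (hR : ∀ i, ‖a i‖ ≤ R) (f : C(cube m R, ℂ)) :
    jointCalculus a hsa hcomm R hR f = 0 ↔
      ∀ χ : WeakDual.characterSpace ℂ (generated a), f (jointCharacter a R hR χ) = 0 := by
  let _ := generatedCommCStar a hsa hcomm
  change (((gelfandStarTransform (generated a)).symm
    (f.comp (jointCharacter a R hR)) : generated a) : A) = 0 ↔ _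
  rw [ZeroMemClass.coe_eq_zero, EmbeddingLike.map_eq_zero_iff, ContinuousMap.ext_iff]
  rfl

theorem isCompact_range_jointCharacter (a : Fin m → A) (hsa : ∀ i, IsSelfAdjoint (a i))
    (hcomm : ∀ i j, Commute (a i) (a j)) (R : ℝ) (hR : ∀ i, ‖a i‖ ≤ R) :
    IsCompact (Set.range (jointCharacter a R hR)) := by
  let _ := generatedCommCStar a hsa hcomm
  exact isCompact_range (jointCharacter a R hR).continuous

/-- Points of the support of the joint functional calculus are the joint values of characters. -/
theorem mem_range_jointCharacter_iff (a : Fin m → A) (hsa : ∀ i, IsSelfAdjoint (a i))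
    (hcomm : ∀ i j, Commute (a i) (a j)) (R : ℝ) (hR : ∀ i, ‖a i‖ ≤ R) (x : cube m R) :
    x ∈ Set.range (jointCharacter a R hR) ↔
      ∀ U ∈ 𝓝 x, ∃ f : C(cube m R, ℂ), tsupport f ⊆ U ∧ jointCalculus a hsa hcomm R hR f ≠ 0 := by
  constructor
  · rintro ⟨χ, rfl⟩ U hU
    obtain ⟨r, hr, hrU⟩ := Metric.nhds_basis_closedBall.mem_iff.1 hU
    set x := jointCharacter a R hR χ
    -- A tent function: positive at x and supported in the closed ball of radius r.
    let f : C(cube m R, ℂ) := ⟨fun y => ((max 0 (r - dist y x) : ℝ) : ℂ), by fun_prop⟩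
    refine ⟨f, ?_, fun h => ?_⟩
    · refine (closure_minimal ?_ Metric.isClosed_closedBall).trans hrU
      intro y hy
      by_contra hyr
      rw [Metric.mem_closedBall, not_le] at hyr
      refine hy ?_
      change ((max 0 (r - dist y x) : ℝ) : ℂ) = 0
      rw [max_eq_left (by linarith), Complex.ofReal_zero]
    · have h1 := (jointCalculus_eq_zero_iff a hsa hcomm R hR f).1 h χ
      change ((max 0 (r - dist x x) : ℝ) : ℂ) = 0 at h1
      rw [dist_self, sub_zero, max_eq_right hr.le, Complex.ofReal_eq_zero] at h1
      exact hr.ne' h1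
  · intro h
    by_contra hx
    -- The range is compact, so its complement is a neighbourhood of x; a function supported there
    -- vanishes at every joint value and is killed by the calculus.
    obtain ⟨f, hf, hf0⟩ := h (Set.range (jointCharacter a R hR))ᶜ
      ((isCompact_range_jointCharacter a hsa hcomm R hR).isClosed.isOpen_compl.mem_nhds hx)
    refine hf0 ((jointCalculus_eq_zero_iff a hsa hcomm R hR f).2 fun χ => ?_)
    by_contra hne
    exact hf (subset_tsupport f hne) ⟨χ, rfl⟩

theorem character_eq_ofReal (a : Fin m → A) (hsa : ∀ i, IsSelfAdjoint (a i)) (R : ℝ)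
    (hR : ∀ i, ‖a i‖ ≤ R) (χ : WeakDual.characterSpace ℂ (generated a)) (i : Fin m) :
    χ ⟨a i, mem_generated a i⟩ = ((jointCharacter a R hR χ).1 i : ℂ) := by
  have hs : IsSelfAdjoint (⟨a i, mem_generated a i⟩ : generated a) := Subtype.ext (hsa i)
  have hχ : star (χ ⟨a i, mem_generated a i⟩) = χ ⟨a i, mem_generated a i⟩ := by
    rw [← map_star, hs.star_eq]
  exact (Complex.conj_eq_iff_re.1 hχ).symm

/-- If no character takes the joint value `x`, then `∑ (aᵢ - xᵢ)²` has a left inverse. -/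
theorem exists_left_inverse_of_notMem (a : Fin m → A) (hsa : ∀ i, IsSelfAdjoint (a i))
    (hcomm : ∀ i j, Commute (a i) (a j)) (R : ℝ) (hR : ∀ i, ‖a i‖ ≤ R) (x : cube m R)
    (hx : x ∉ Set.range (jointCharacter a R hR)) :
    ∃ b : A, b * ∑ i, (a i - (x.1 i : ℂ) • 1) * (a i - (x.1 i : ℂ) • 1) = 1 := by
  let _ := generatedCommCStar a hsa hcomm
  let a' : Fin m → generated a := fun i => ⟨a i, mem_generated a i⟩
  set h : generated a := ∑ i, (a' i - (x.1 i : ℂ) • 1) * (a' i - (x.1 i : ℂ) • 1) with hh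
  have hu : IsUnit h := by
    by_contra hu
    -- A non-unit of a commutative C*-algebra is annihilated by some character. Here χ(h) is a sum
    -- of squares of real numbers, so χ(a_i) = x_i for every i.
    obtain ⟨χ, hχ⟩ := WeakDual.CharacterSpace.exists_apply_eq_zero hu
    refine hx ⟨χ, Subtype.ext (funext fun i => ?_)⟩
    have h1 : χ h = ((∑ i, ((jointCharacter a R hR χ).1 i - x.1 i) ^ 2 : ℝ) : ℂ) := by
      rw [hh, map_sum]
      push_cast
      refine Finset.sum_congr rfl fun i _ => ?_
      rw [map_mul, map_sub, map_smul, map_one, character_eq_ofReal a hsa R hR χ i, smul_eq_mul,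
        mul_one, sq]
    rw [h1, Complex.ofReal_eq_zero, Finset.sum_eq_zero_iff_of_nonneg fun i _ => sq_nonneg _] at hχ
    have := hχ i (Finset.mem_univ i)
    exact sub_eq_zero.1 (pow_eq_zero_iff two_ne_zero |>.1 this)
  obtain ⟨b, hb⟩ := hu.exists_left_inv
  refine ⟨b, ?_⟩
  have h2 := congrArg (fun y : generated a => (y : A)) hb
  simpa [hh, a'] using h2

end JointSpectrum

/-! ### Elementary tensors and independence of sites in a product density. -/

section Tensor

variable {d : ℕ} {ι : Type*} [Fintype ι]

/-- The elementary tensor `⨂ⱼ Xⱼ`, as a matrix indexed by configurations. -/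
def tensorMat (X : ι → Matrix (Fin d) (Fin d) ℂ) : Matrix (ι → Fin d) (ι → Fin d) ℂ :=
  Matrix.of fun s t => ∏ j, X j (s j) (t j)

theorem tensorMat_apply (X : ι → Matrix (Fin d) (Fin d) ℂ) (s t : ι → Fin d) :
    tensorMat X s t = ∏ j, X j (s j) (t j) := rfl

theorem tensorMat_mul [DecidableEq ι] (X Y : ι → Matrix (Fin d) (Fin d) ℂ) :
    tensorMat X * tensorMat Y = tensorMat fun j => X j * Y j := by
  ext s t
  simp only [Matrix.mul_apply, tensorMat_apply, Finset.prod_univ_sum, Fintype.piFinset_univ,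
    Finset.prod_mul_distrib]

theorem trace_tensorMat [DecidableEq ι] (X : ι → Matrix (Fin d) (Fin d) ℂ) :
    (tensorMat X).trace = ∏ j, (X j).trace := by
  simp only [Matrix.trace, Matrix.diag, tensorMat_apply, Finset.prod_univ_sum,
    Fintype.piFinset_univ]

theorem conjTranspose_tensorMat (X : ι → Matrix (Fin d) (Fin d) ℂ) :
    (tensorMat X).conjTranspose = tensorMat fun j => (X j).conjTranspose := by
  ext s t
  simp [tensorMat_apply, Matrix.conjTranspose_apply]

/-- The identity factors away from j vanish unless s and t agree there. In this form traces against
a product density factor over the sites. -/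
theorem siteEmb_eq_tensorMat (Λ : Finset ℤ) (j : Λ) (A : Matrix (Fin d) (Fin d) ℂ) :
    siteEmb d Λ j A = tensorMat (Function.update (fun _ => 1) j A) := by
  ext s t
  rw [siteEmb_apply, tensorMat_apply]
  split_ifs with h
  · rw [Finset.prod_eq_single j]
    · simp
    · intro k _ hk
      simp [hk, h k hk]
    · simp
  · push Not at h
    obtain ⟨k, hk, hst⟩ := h
    exact (Finset.prod_eq_zero (Finset.mem_univ k) (by simp [hk, hst])).symm

theorem trace_tensorMat_mul_siteEmb (Λ : Finset ℤ) {ρ : Matrix (Fin d) (Fin d) ℂ}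
    (hρ : ρ.trace = 1) (j : Λ) (A : Matrix (Fin d) (Fin d) ℂ) :
    (tensorMat (fun _ : Λ => ρ) * siteEmb d Λ j A).trace = (ρ * A).trace := by
  rw [siteEmb_eq_tensorMat, tensorMat_mul, trace_tensorMat, Finset.prod_eq_single j]
  · simp
  · intro k _ hk
    simp [hk, hρ]
  · simp

/-- Distinct sites are uncorrelated: the trace is a product over sites, and the factor at j is
Tr(ρC) = 0. -/
theorem trace_tensorMat_mul_siteEmb_mul (Λ : Finset ℤ) {ρ C : Matrix (Fin d) (Fin d) ℂ}
    (hC : (ρ * C).trace = 0) {j k : Λ} (hjk : j ≠ k) :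
    (tensorMat (fun _ : Λ => ρ) * (siteEmb d Λ j C * siteEmb d Λ k C)).trace = 0 := by
  rw [siteEmb_eq_tensorMat, siteEmb_eq_tensorMat, tensorMat_mul, tensorMat_mul, trace_tensorMat]
  refine Finset.prod_eq_zero (Finset.mem_univ j) ?_
  simp [hjk, hC]

/-- The variance of a spatial mean in a product state decays like the inverse volume. -/
theorem trace_tensorMat_mul_meanObs_sq (n : ℕ) {ρ C : Matrix (Fin d) (Fin d) ℂ}
    (hρ : ρ.trace = 1) (hC : (ρ * C).trace = 0) :
    (tensorMat (fun _ : window n => ρ) * (meanObs n C * meanObs n C)).trace =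
      ((2 * n + 1 : ℝ)⁻¹ : ℂ) * (ρ * (C * C)).trace := by
  have h : (tensorMat (fun _ : window n => ρ) *
      ((∑ j, siteEmb d (window n) j C) * ∑ j, siteEmb d (window n) j C)).trace =
      (2 * n + 1 : ℂ) * (ρ * (C * C)).trace := by
    rw [Finset.sum_mul_sum, Finset.mul_sum, Matrix.trace_sum]
    -- Only the diagonal terms k = j of the double sum survive, so 2n+1 equal terms stand against
    -- the normalization (2n+1)⁻².
    have h1 : ∀ j : window n, (tensorMat (fun _ : window n => ρ) *
        ∑ k, siteEmb d (window n) j C * siteEmb d (window n) k C).trace =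
        (ρ * (C * C)).trace := by
      intro j
      rw [Finset.mul_sum, Matrix.trace_sum, Finset.sum_eq_single j]
      · rw [← map_mul, trace_tensorMat_mul_siteEmb _ hρ]
      · intro k _ hk
        exact trace_tensorMat_mul_siteEmb_mul _ hC hk.symm
      · simp
    rw [Finset.sum_congr rfl fun j _ => h1 j, Finset.sum_const, Finset.card_univ, card_window,
      nsmul_eq_mul]
    push_cast
    rfl
  have hne : (2 * n + 1 : ℂ) ≠ 0 := by exact_mod_cast (by positivity : (2 * n + 1 : ℝ) ≠ 0)
  simp only [meanObs, smul_mul_assoc, mul_smul_comm, Matrix.trace_smul, smul_eq_mul, h]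
  push_cast
  field_simp

end Tensor

/-! ### Approximate joint null vectors from small variance. -/

section ApproximateEigenvector

open scoped ComplexOrder MatrixOrder

variable {ι : Type*} [Fintype ι]

/-- Both sides are the squared Hilbert-Schmidt norm of YT, by cyclicity of the trace. When TT* is a
density matrix, the expectation of Y*Y becomes a sum over the columns of T, and no eigenvectors are
needed. -/
theorem sum_norm_sq_mulVec_col [DecidableEq ι] (Y T : Matrix ι ι ℂ) :
    ((∑ u, ‖Matrix.toEuclideanCLM (𝕜 := ℂ) Y (WithLp.toLp 2 fun s => T s u)‖ ^ 2 : ℝ) : ℂ) =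
      (T * T.conjTranspose * (Y.conjTranspose * Y)).trace := by
  have h : T * T.conjTranspose * (Y.conjTranspose * Y) =
      T * ((Y * T).conjTranspose * Y) := by
    rw [Matrix.conjTranspose_mul]
    simp only [Matrix.mul_assoc]
  rw [h, Matrix.trace_mul_comm, Matrix.mul_assoc, Matrix.trace]
  push_cast
  refine Finset.sum_congr rfl fun u _ => ?_
  rw [← Complex.ofReal_pow, EuclideanSpace.norm_sq_eq, Matrix.diag_apply, Matrix.mul_apply]
  push_cast
  refine Finset.sum_congr rfl fun s _ => ?_
  rw [Matrix.conjTranspose_apply, Matrix.toEuclideanCLM_toLp, ← Complex.conj_mul']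
  rfl

/-- A finite family of vectors contains a non-zero vector on which a quadratic inequality that
holds on average holds. -/
theorem exists_ne_zero_le {V : Type*} [NormedAddCommGroup V] (v : ι → V) (q : V → ℝ)
    (hq : 0 ≤ q 0) (K : ℝ) (hv : ∑ u, ‖v u‖ ^ 2 = 1) (hqK : ∑ u, q (v u) ≤ K) :
    ∃ w : V, w ≠ 0 ∧ q w ≤ K * ‖w‖ ^ 2 := by
  by_contra! h
  have hle : ∀ u, K * ‖v u‖ ^ 2 ≤ q (v u) := by
    intro u
    by_cases hu : v u = 0
    · simpa [hu] using hq
    · exact (h _ hu).le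
  have hex : ∃ u, v u ≠ 0 := by
    by_contra! h0
    simp [h0] at hv
  obtain ⟨u, hu⟩ := hex
  have hlt := Finset.sum_lt_sum (fun u _ => hle u) ⟨u, Finset.mem_univ u, h _ hu⟩
  rw [← Finset.mul_sum, hv, mul_one] at hlt
  linarith

/-- The spatial means of one-site observables with vanishing expectations in a one-site state
have a common approximate null vector. -/
theorem exists_approximate_null_vector {d m : ℕ} {ρ : Matrix (Fin d) (Fin d) ℂ}
    (hρ : ρ.PosSemidef) (htr : ρ.trace = 1) (C : Fin m → Matrix (Fin d) (Fin d) ℂ)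
    (hCs : ∀ i, (C i).IsHermitian) (hC : ∀ i, (ρ * C i).trace = 0) (n : ℕ) :
    ∃ w : EuclideanSpace ℂ (window n → Fin d), w ≠ 0 ∧
      ∑ i, ‖Matrix.toEuclideanCLM (𝕜 := ℂ) (meanObs n (C i)) w‖ ^ 2 ≤
        ((2 * n + 1 : ℝ)⁻¹ * ∑ i, (ρ * (C i * C i)).trace.re) * ‖w‖ ^ 2 := by
  -- Factoring ρ on one site factors the product density as TT* with T = B ⊗ … ⊗ B; the vector
  -- sought is a column of T.
  obtain ⟨B, hB⟩ : ∃ B : Matrix (Fin d) (Fin d) ℂ, ρ = B * B.conjTranspose := by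
    obtain ⟨B, hB⟩ := CStarAlgebra.nonneg_iff_eq_star_mul_self.1
      hρ.nonneg
    exact ⟨star B, by simpa [Matrix.star_eq_conjTranspose] using hB⟩
  set T := tensorMat fun _ : window n => B
  have hT : T * T.conjTranspose = tensorMat fun _ : window n => ρ := by
    rw [conjTranspose_tensorMat, tensorMat_mul, hB]
  refine exists_ne_zero_le (fun u => WithLp.toLp 2 fun s => T s u)
    (fun w => ∑ i, ‖Matrix.toEuclideanCLM (𝕜 := ℂ) (meanObs n (C i)) w‖ ^ 2)
    (Finset.sum_nonneg fun i _ => sq_nonneg _) _ ?_ (le_of_eq ?_)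
  -- The case Y = 1: the squared norms of the columns add up to the trace of the product density,
  -- which is 1.
  · have h := sum_norm_sq_mulVec_col (1 : Matrix (window n → Fin d) (window n → Fin d) ℂ) T
    rw [hT] at h
    simp only [map_one, Matrix.conjTranspose_one, mul_one, trace_tensorMat, htr,
      Finset.prod_const_one] at h
    exact_mod_cast h
  · rw [Finset.sum_comm, Finset.mul_sum]
    refine Finset.sum_congr rfl fun i _ => ?_
    have h := sum_norm_sq_mulVec_col (meanObs n (C i)) T
    have hs : (meanObs n (C i)).conjTranspose = meanObs n (C i) :=
      isSelfAdjoint_meanObs n (hCs i)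
    rw [hT, hs, trace_tensorMat_mul_meanObs_sq n htr (hC i)] at h
    have h2 := congrArg Complex.re h
    rw [Complex.ofReal_re, ← Complex.ofReal_inv, Complex.re_ofReal_mul] at h2
    exact h2

end ApproximateEigenvector

/-! ### Density matrices and nonnegativity of entropy. -/

section MatrixStates

open scoped ComplexOrder MatrixOrder

variable {ι : Type*} [Fintype ι] [DecidableEq ι]

/-- The density matrix of a linear functional on a matrix algebra. -/
def functionalDensity (p : Matrix ι ι ℂ →ₗ[ℂ] ℂ) : Matrix ι ι ℂ :=
  Matrix.of fun s t => p (Matrix.single t s 1)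

theorem trace_functionalDensity_mul (p : Matrix ι ι ℂ →ₗ[ℂ] ℂ) (M : Matrix ι ι ℂ) :
    (functionalDensity p * M).trace = p M := by
  conv_rhs => rw [Matrix.matrix_eq_sum_single M]
  simp only [map_sum, Matrix.trace, Matrix.diag, Matrix.mul_apply, functionalDensity,
    Matrix.of_apply]
  rw [Finset.sum_comm]
  refine Finset.sum_congr rfl fun s _ => Finset.sum_congr rfl fun t _ => ?_
  have h : Matrix.single s t (M s t) = M s t • Matrix.single s t (1 : ℂ) := by
    rw [Matrix.smul_single, smul_eq_mul, mul_one]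
  rw [h, map_smul, smul_eq_mul, mul_comm]

/-- Every rank-one matrix xx* has the form M*M, with M = e_i x* for any index i, and Tr(ρ xx*) is
the quadratic form of ρ at x. -/
theorem posSemidef_of_trace_mul_nonneg (ρ : Matrix ι ι ℂ)
    (h : ∀ M : Matrix ι ι ℂ, 0 ≤ (ρ * (star M * M)).trace) : ρ.PosSemidef := by
  have key : ∀ x : ι → ℂ, 0 ≤ star x ⬝ᵥ (ρ.mulVec x) := by
    intro x
    by_cases hι : Nonempty ι
    · obtain ⟨i⟩ := hι
      let M : Matrix ι ι ℂ := Matrix.vecMulVec (Pi.single i 1) (star x)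
      have hM : star M * M = Matrix.vecMulVec x (star x) := by
        ext s t
        simp [M, Matrix.star_eq_conjTranspose, Matrix.mul_apply, Matrix.vecMulVec_apply,
          Pi.single_apply]
      have h1 := h M
      rw [hM, Matrix.mul_vecMulVec, Matrix.trace_vecMulVec, dotProduct_comm] at h1
      exact h1
    · rw [not_nonempty_iff] at hι
      simp
  rw [← Matrix.isPositive_toEuclideanLin_iff, LinearMap.isPositive_iff_complex]
  intro v
  have h1 : 0 ≤ inner ℂ v (Matrix.toEuclideanLin ρ v) := by
    rw [EuclideanSpace.inner_eq_star_dotProduct, dotProduct_comm]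
    exact key (WithLp.ofLp v)
  obtain ⟨h2, h3⟩ := Complex.nonneg_iff.1 h1
  rw [← inner_conj_symm]
  refine ⟨Complex.ext rfl ?_, h2⟩
  rw [Complex.conj_im, ← h3, neg_zero]
  exact Complex.ofReal_im _

/-- The eigenvalues are nonnegative with sum 1, hence lie in [0, 1], where -t log t is nonnegative.
-/
theorem trace_cfc_negMulLog_nonneg {ρ : Matrix ι ι ℂ} (hρ : ρ.PosSemidef) (htr : ρ.trace = 1) :
    0 ≤ (cfc Real.negMulLog ρ).trace.re := by
  have hsum : ∑ i, hρ.1.eigenvalues i = 1 := by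
    have h := hρ.1.trace_eq_sum_eigenvalues
    rw [htr] at h
    have h2 := congrArg Complex.re h
    simpa using h2.symm
  have h0 : 0 ≤ cfc Real.negMulLog ρ := by
    refine cfc_nonneg fun x hx => ?_
    rw [hρ.1.spectrum_real_eq_range_eigenvalues] at hx
    obtain ⟨i, rfl⟩ := hx
    refine Real.negMulLog_nonneg (hρ.eigenvalues_nonneg i) ?_
    rw [← hsum]
    exact Finset.single_le_sum (fun j _ => hρ.eigenvalues_nonneg j) (Finset.mem_univ i)
  exact (Complex.le_def.1 (Matrix.nonneg_iff_posSemidef.1 h0).trace_nonneg).1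

end MatrixStates

/-! ### One-site expectations are joint values of characters. -/

section ProductStates

open scoped ComplexOrder

variable {d m : ℕ}

theorem meanObs_sub_smul_one (n : ℕ) (A : Matrix (Fin d) (Fin d) ℂ) (c : ℂ) :
    meanObs n (A - c • 1) = meanObs n A - c • 1 := by
  have hne : ((2 * n + 1 : ℝ) : ℂ) ≠ 0 := by
    exact_mod_cast (by positivity : (2 * n + 1 : ℝ) ≠ 0)
  simp only [meanObs, map_sub, map_smul, map_one, Finset.sum_sub_distrib, smul_sub,
    Finset.sum_const, Finset.card_univ, card_window]
  congr 1
  rw [← Nat.cast_smul_eq_nsmul ℂ, smul_smul]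
  push_cast at hne ⊢
  rw [inv_mul_cancel₀ hne, one_smul]

/-- Write w as Zw - (Z - 1)w with Z = b ∑ Y_i². The first term is small because each Y_i w is, the
second because Z is close to 1; dividing by ‖w‖ gives the bound. It quantifies that approximate null
vectors obstruct a left inverse. -/
theorem one_le_of_approximate_null_vector {ι : Type*} [Fintype ι] [DecidableEq ι]
    (b : Matrix ι ι ℂ) (Y : Fin m → Matrix ι ι ℂ) {w : EuclideanSpace ℂ ι} (hw : w ≠ 0) {s : ℝ}
    (hY : ∀ i, ‖Matrix.toEuclideanCLM (𝕜 := ℂ) (Y i) w‖ ≤ s * ‖w‖) :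
    1 ≤ ‖b * ∑ i, Y i * Y i - 1‖ + ‖b‖ * (∑ i, ‖Y i‖) * s := by
  have hop : ∀ (M : Matrix ι ι ℂ) (v : EuclideanSpace ℂ ι),
      ‖Matrix.toEuclideanCLM (𝕜 := ℂ) M v‖ ≤ ‖M‖ * ‖v‖ := fun M v =>
    (Matrix.toEuclideanCLM (𝕜 := ℂ) M).le_opNorm v
  have h3 : ‖Matrix.toEuclideanCLM (𝕜 := ℂ) (b * ∑ i, Y i * Y i) w‖ ≤
      ‖b‖ * (∑ i, ‖Y i‖) * s * ‖w‖ := by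
    rw [map_mul, map_sum, mul_apply_eq_comp, sum_apply]
    refine (hop _ _).trans ?_
    rw [mul_assoc, mul_assoc]
    refine mul_le_mul_of_nonneg_left ?_ (norm_nonneg _)
    rw [Finset.sum_mul]
    refine norm_sum_le_of_le _ fun i _ => ?_
    rw [map_mul, mul_apply_eq_comp]
    exact (hop _ _).trans (mul_le_mul_of_nonneg_left (hY i) (norm_nonneg _))
  have h5 := hop (b * ∑ i, Y i * Y i - 1) w
  rw [map_sub, map_one, sub_apply, one_apply_eq_self] at h5
  have h8 := norm_sub_le (Matrix.toEuclideanCLM (𝕜 := ℂ) (b * ∑ i, Y i * Y i) w)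
    (Matrix.toEuclideanCLM (𝕜 := ℂ) (b * ∑ i, Y i * Y i) w - w)
  rw [sub_sub_cancel] at h8
  exact le_of_mul_le_mul_right (by linarith) (norm_pos_iff.2 hw)

variable [NeZero d]

/-- The expectations of the observables in a one-site density matrix are the joint value of a
character of the algebra generated by the macroscopic observables. -/
theorem mem_range_jointCharacter_of_density (A : Fin m → Matrix (Fin d) (Fin d) ℂ)
    (hA : ∀ i, (A i).IsHermitian) (n : ℕ → ℕ) (hn : StrictMono n) (R : ℝ)
    (hR : ∀ i, ‖obs n (A i)‖ ≤ R) {ρ : Matrix (Fin d) (Fin d) ℂ} (hρ : ρ.PosSemidef)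
    (htr : ρ.trace = 1) (x : cube m R) (hx : ∀ i, (ρ * A i).trace = (x.1 i : ℂ)) :
    x ∈ Set.range (jointCharacter (fun i => obs n (A i)) R hR) := by
  by_contra hmem
  obtain ⟨b, hb⟩ := exists_left_inverse_of_notMem (fun i => obs n (A i))
    (fun i => isSelfAdjoint_obs n (hA i)) (fun i j => obs_commute hn (A i) (A j)) R hR x hmem
  -- The left inverse in the quotient is lifted to a bounded sequence β; at level k it is a left
  -- inverse only up to an error δ k that tends to 0.
  obtain ⟨β, rfl⟩ := SeqQuot.mkₐ_surjective b
  let C : Fin m → Matrix (Fin d) (Fin d) ℂ := fun i => A i - (x.1 i : ℂ) • 1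
  have hCs : ∀ i, (C i).IsHermitian := by
    intro i
    have h1 : IsSelfAdjoint (A i) := hA i
    refine h1.sub (IsSelfAdjoint.smul ?_ (IsSelfAdjoint.one _))
    exact Complex.conj_ofReal _
  have hC0 : ∀ i, (ρ * C i).trace = 0 := by
    intro i
    simp only [C, mul_sub, mul_smul_comm, mul_one, Matrix.trace_sub, Matrix.trace_smul, hx, htr,
      smul_eq_mul, sub_self]
  have hobs : ∀ i, obs n (A i) - (x.1 i : ℂ) • 1 = SeqQuot.mkₐ _ (obsSeq n (C i)) := by
    intro i
    have h1 : obsSeq n (C i) = obsSeq n (A i) - (x.1 i : ℂ) • 1 :=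
      lp.ext (funext fun k => meanObs_sub_smul_one (n k) (A i) (x.1 i))
    rw [h1, map_sub, map_smul, map_one]
    rfl
  simp only [hobs] at hb
  have hb' : SeqQuot.mkₐ _ (β * ∑ i, obsSeq n (C i) * obsSeq n (C i)) =
      SeqQuot.mkₐ (WindowAlg d n) 1 := by
    simp only [map_mul, map_sum, map_one]
    exact hb
  rw [SeqQuot.mkₐ_eq_iff, mem_nullIdeal] at hb'
  set δ : ℕ → ℝ := fun k => ‖(β * ∑ i, obsSeq n (C i) * obsSeq n (C i) - 1 :
    BddSeq (WindowAlg d n)) k‖ with hδ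
  have hcoe : ∀ k, (β * ∑ i, obsSeq n (C i) * obsSeq n (C i) - 1 : BddSeq (WindowAlg d n)) k =
      β k * ∑ i, meanObs (n k) (C i) * meanObs (n k) (C i) - 1 := by
    intro k
    change β k * (∑ i, obsSeq n (C i) * obsSeq n (C i) : BddSeq (WindowAlg d n)) k - 1 = _
    rw [lp.coeFn_sum, Finset.sum_apply]
    rfl
  set K : ℝ := ∑ i, (ρ * (C i * C i)).trace.re
  set L : ℝ := ‖β‖ * ∑ i, ‖C i‖
  have hineq : ∀ k, 1 ≤ δ k + L * √((2 * n k + 1 : ℝ)⁻¹ * K) := by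
    intro k
    obtain ⟨w, hw, hwC⟩ := exists_approximate_null_vector hρ htr C hCs hC0 (n k)
    have hCw : ∀ i, ‖Matrix.toEuclideanCLM (𝕜 := ℂ) (meanObs (n k) (C i)) w‖ ≤
        √((2 * n k + 1 : ℝ)⁻¹ * K) * ‖w‖ := by
      intro i
      have h1 := (Finset.single_le_sum (f := fun i =>
        ‖Matrix.toEuclideanCLM (𝕜 := ℂ) (meanObs (n k) (C i)) w‖ ^ 2)
        (fun j _ => sq_nonneg _) (Finset.mem_univ i)).trans hwC
      have h2 := Real.sqrt_le_sqrt h1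
      rwa [Real.sqrt_sq (norm_nonneg _), Real.sqrt_mul' _ (sq_nonneg _),
        Real.sqrt_sq (norm_nonneg _)] at h2
    have h3 := one_le_of_approximate_null_vector (β k) (fun i => meanObs (n k) (C i)) hw hCw
    refine h3.trans (add_le_add (le_of_eq ?_) (mul_le_mul_of_nonneg_right ?_ (Real.sqrt_nonneg _)))
    · exact congrArg norm (hcoe k).symm
    · exact mul_le_mul (lp.norm_apply_le_norm ENNReal.top_ne_zero β k)
        (Finset.sum_le_sum fun i _ => norm_meanObs_le _ _)
        (Finset.sum_nonneg fun i _ => norm_nonneg _) (norm_nonneg _)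
  have hlim : Tendsto (fun k => δ k + L * √((2 * n k + 1 : ℝ)⁻¹ * K)) atTop
      (𝓝 (0 + L * √(0 * K))) := by
    refine hb'.add (Tendsto.const_mul L (Real.continuous_sqrt.continuousAt.tendsto.comp
      (Tendsto.mul_const K (Tendsto.inv_tendsto_atTop ?_))))
    exact tendsto_atTop_add_const_right _ _
      ((tendsto_natCast_atTop_atTop.comp hn.tendsto_atTop).const_mul_atTop (by norm_num))
  -- In the limit `hineq` reads 1 ≤ 0, since both the defect of the inverse and the variance bound
  -- vanish.
  have := ge_of_tendsto' hlim hineq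
  simp at this
  linarith

end ProductStates

/-! ### Compressing operators on ℓ² to a finite window. -/

section Compression

variable {d : ℕ}

theorem overwrite_injective (Λ : Finset ℤ) (σ : Config d) :
    Function.Injective fun t : Λ → Fin d => overwrite Λ t σ := by
  intro s t h
  rw [← restrict_overwrite Λ s σ, ← restrict_overwrite Λ t σ]
  exact congrArg Λ.restrict h

/-- The restriction of a vector of `ℓ²(Config d)` to the configurations equal to `σ` off `Λ`. -/
def restrictVec (Λ : Finset ℤ) (σ : Config d) :
    ConfigSpace d →L[ℂ] EuclideanSpace ℂ (Λ → Fin d) :=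
  LinearMap.mkContinuous
    { toFun := fun ψ => WithLp.toLp 2 fun t => ψ (overwrite Λ t σ)
      map_add' := fun _ _ => rfl
      map_smul' := fun _ _ => rfl } 1
    (by
      intro ψ
      classical
      rw [one_mul]
      refine (sq_le_sq₀ (norm_nonneg _) (norm_nonneg _)).1 ?_
      rw [EuclideanSpace.norm_sq_eq]
      change ∑ t, ‖ψ (overwrite Λ t σ)‖ ^ 2 ≤ _
      have h := lp.sum_rpow_le_norm_rpow (p := 2) (by norm_num) ψ
        (Finset.univ.image fun t : Λ → Fin d => overwrite Λ t σ)
      rw [Finset.sum_image fun s _ t _ hst => overwrite_injective Λ σ hst] at h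
      simpa using h)

theorem restrictVec_apply (Λ : Finset ℤ) (σ : Config d) (ψ : ConfigSpace d) (t : Λ → Fin d) :
    restrictVec Λ σ ψ t = ψ (overwrite Λ t σ) := rfl

theorem norm_restrictVec_le (Λ : Finset ℤ) (σ : Config d) : ‖restrictVec Λ σ‖ ≤ 1 :=
  LinearMap.mkContinuous_norm_le _ zero_le_one _

/-- The restriction sends the basis vector at `overwrite Λ t σ` to the basis vector at t, so it is a
coisometry. -/
theorem restrictVec_comp_adjoint (Λ : Finset ℤ) (σ : Config d) :
    restrictVec Λ σ ∘L ContinuousLinearMap.adjoint (restrictVec Λ σ) =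
      ContinuousLinearMap.id ℂ (EuclideanSpace ℂ (Λ → Fin d)) := by
  classical
  ext v t
  have h1 : ∀ τ : Config d, ∀ ψ : ConfigSpace d,
      inner ℂ (lp.single 2 τ (1 : ℂ) : ConfigSpace d) ψ = ψ τ := by
    intro τ ψ
    rw [lp.inner_single_left]
    simp
  have h2 : restrictVec Λ σ (lp.single 2 (overwrite Λ t σ) (1 : ℂ)) =
      EuclideanSpace.single t (1 : ℂ) := by
    ext s
    rw [restrictVec_apply]
    by_cases hst : s = t
    · subst hst
      simp
    · rw [lp.single_apply_ne, PiLp.single_apply, if_neg hst]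
      exact fun h => hst (overwrite_injective Λ σ h)
  rw [ContinuousLinearMap.comp_apply, restrictVec_apply, ← h1,
    ContinuousLinearMap.adjoint_inner_right, h2,
    EuclideanSpace.inner_single_left]
  simp

theorem restrictVec_localRep (Λ : Finset ℤ) (σ : Config d) (M : LocalAlg d Λ)
    (ψ : ConfigSpace d) :
    restrictVec Λ σ (localRep d Λ M ψ) =
      Matrix.toEuclideanCLM (𝕜 := ℂ) M (restrictVec Λ σ ψ) := by
  ext s
  rw [restrictVec_apply, localRep_apply, restrict_overwrite]
  simp only [overwrite_overwrite]
  rfl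

/-- The compression of an operator on `ℓ²(Config d)` to the configurations equal to `σ` off `Λ`. -/
def compression (Λ : Finset ℤ) (σ : Config d) :
    (ConfigSpace d →L[ℂ] ConfigSpace d) →ₗ[ℂ] LocalAlg d Λ where
  toFun T := (Matrix.toEuclideanCLM (𝕜 := ℂ)).symm
    (restrictVec Λ σ ∘L T ∘L ContinuousLinearMap.adjoint (restrictVec Λ σ))
  map_add' S T := by
    rw [ContinuousLinearMap.add_comp, ContinuousLinearMap.comp_add, map_add]
  map_smul' c T := by
    rw [ContinuousLinearMap.smul_comp, ContinuousLinearMap.comp_smul, map_smul, RingHom.id_apply]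

theorem norm_compression_le (Λ : Finset ℤ) (σ : Config d)
    (T : ConfigSpace d →L[ℂ] ConfigSpace d) : ‖compression Λ σ T‖ ≤ ‖T‖ := by
  have h1 := norm_restrictVec_le Λ σ
  refine (Matrix.l2_opNorm_toEuclideanCLM (compression Λ σ T)).symm.trans_le ?_
  have h2 : Matrix.toEuclideanCLM (𝕜 := ℂ) (compression Λ σ T) =
      restrictVec Λ σ ∘L T ∘L ContinuousLinearMap.adjoint (restrictVec Λ σ) :=
    StarAlgEquiv.apply_symm_apply _ _
  rw [h2]
  refine (ContinuousLinearMap.opNorm_comp_le _ _).trans ?_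
  refine (mul_le_of_le_one_left (norm_nonneg _) h1).trans ?_
  refine (ContinuousLinearMap.opNorm_comp_le _ _).trans ?_
  refine mul_le_of_le_one_right (norm_nonneg _) ?_
  rwa [LinearIsometryEquiv.norm_map]

/-- A local operator leaves the configuration off Λ untouched, so restriction V intertwines it with
M and V(M ⊗ 1)V* = MVV* = M. Thus compression is a contractive linear left inverse of the embedding.
-/
theorem compression_localRep (Λ : Finset ℤ) (σ : Config d) (M : LocalAlg d Λ) :
    compression Λ σ (localRep d Λ M) = M := by
  have h : restrictVec Λ σ ∘L localRep d Λ M ∘L ContinuousLinearMap.adjoint (restrictVec Λ σ) =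
      Matrix.toEuclideanCLM (𝕜 := ℂ) M := by
    ext1 v
    have h1 := congrArg (fun T => T v) (restrictVec_comp_adjoint Λ σ)
    change restrictVec Λ σ (localRep d Λ M _) = _
    rw [restrictVec_localRep]
    exact congrArg (Matrix.toEuclideanCLM (𝕜 := ℂ) M) h1
  change (Matrix.toEuclideanCLM (𝕜 := ℂ)).symm _ = _
  rw [h, StarAlgEquiv.symm_apply_apply]

end Compression

/-! ### Spatial means and their asymptotic invariance. -/

section Averages

variable {d : ℕ}

/-- Conjugation by the shift by `j`, on all bounded operators. -/
def shiftConj (d : ℕ) (j : ℤ) :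
    (ConfigSpace d →L[ℂ] ConfigSpace d) →⋆ₐ[ℂ] (ConfigSpace d →L[ℂ] ConfigSpace d) :=
  (shiftUnitary d j).conjStarAlgEquiv

theorem shiftConj_apply (j : ℤ) (T : ConfigSpace d →L[ℂ] ConfigSpace d) (ψ : ConfigSpace d) :
    shiftConj d j T ψ = shiftOp d j (T (shiftOp d (-j) ψ)) := rfl

theorem shiftOp_add (j l : ℤ) (ψ : ConfigSpace d) :
    shiftOp d j (shiftOp d l ψ) = shiftOp d (j + l) ψ := by
  ext σ
  simp only [shiftOp_apply]
  refine congrArg (fun τ => ψ τ) (funext fun i => ?_)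
  simp only [shiftConfig]
  congr 1
  ring

theorem shiftConj_shiftConj (j l : ℤ) (T : ConfigSpace d →L[ℂ] ConfigSpace d) :
    shiftConj d j (shiftConj d l T) = shiftConj d (j + l) T := by
  ext1 ψ
  rw [shiftConj_apply, shiftConj_apply, shiftConj_apply, shiftOp_add, shiftOp_add, neg_add_rev]

theorem shiftConj_zero (T : ConfigSpace d →L[ℂ] ConfigSpace d) : shiftConj d 0 T = T := by
  have h : ∀ ψ : ConfigSpace d, shiftOp d 0 ψ = ψ := by
    intro ψ
    ext σ
    rw [shiftOp_apply]
    exact congrArg (fun τ => ψ τ) (funext fun i => congrArg σ (add_zero i))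
  ext1 ψ
  rw [shiftConj_apply, neg_zero, h, h]

theorem norm_shiftConj_le (j : ℤ) (T : ConfigSpace d →L[ℂ] ConfigSpace d) :
    ‖shiftConj d j T‖ ≤ ‖T‖ :=
  NonUnitalStarAlgHom.norm_apply_le (shiftConj d j) T

/-- The spatial mean of the translates of an operator by the sites of `[-n, n]`. -/
def shiftMean (d n : ℕ) :
    (ConfigSpace d →L[ℂ] ConfigSpace d) →ₗ[ℂ] (ConfigSpace d →L[ℂ] ConfigSpace d) :=
  ((2 * n + 1 : ℝ)⁻¹ : ℂ) • ∑ j ∈ window n, (shiftConj d j).toLinearMap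

theorem shiftMean_apply (n : ℕ) (T : ConfigSpace d →L[ℂ] ConfigSpace d) :
    shiftMean d n T = ((2 * n + 1 : ℝ)⁻¹ : ℂ) • ∑ j ∈ window n, shiftConj d j T := by
  simp [shiftMean]

theorem norm_inv_card_window (n : ℕ) :
    ‖((2 * n + 1 : ℝ)⁻¹ : ℂ)‖ = (2 * n + 1 : ℝ)⁻¹ := by
  rw [← Complex.ofReal_inv, Complex.norm_real, Real.norm_of_nonneg (by positivity)]

theorem norm_shiftMean_le (n : ℕ) (T : ConfigSpace d →L[ℂ] ConfigSpace d) :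
    ‖shiftMean d n T‖ ≤ ‖T‖ := by
  rw [shiftMean_apply, norm_smul, norm_inv_card_window, inv_mul_le_iff₀ (by positivity)]
  refine (norm_sum_le_of_le _ fun j _ => norm_shiftConj_le j T).trans (le_of_eq ?_)
  rw [Finset.sum_const, ← Fintype.card_coe, card_window, nsmul_eq_mul]
  push_cast
  rfl

theorem shiftMean_oneSite (n : ℕ) (A : Matrix (Fin d) (Fin d) ℂ) :
    shiftMean d n (oneSite A : quasiLocal d).1 = localRep d (window n) (meanObs n A) := by
  have h := congrArg (quasiLocal d).subtype (incl_meanObs n A)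
  rw [map_smul, map_sum] at h
  rw [shiftMean_apply]
  exact h.symm

theorem shiftMean_one (n : ℕ) : shiftMean d n 1 = 1 := by
  have hne : ((2 * n + 1 : ℝ) : ℂ) ≠ 0 := by
    exact_mod_cast (by positivity : (2 * n + 1 : ℝ) ≠ 0)
  rw [shiftMean_apply]
  simp only [map_one]
  rw [Finset.sum_const, ← Fintype.card_coe, card_window, ← Nat.cast_smul_eq_nsmul ℂ, smul_smul]
  push_cast at hne ⊢
  rw [inv_mul_cancel₀ hne, one_smul]

/-- The windows [-n+1, n+1] and [-n, n] differ only in their end sites n+1 and -n. -/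
theorem sum_window_succ_sub {G : Type*} [AddCommGroup G] (n : ℕ) (f : ℤ → G) :
    ∑ j ∈ window n, f (j + 1) - ∑ j ∈ window n, f j = f (n + 1) - f (-n) := by
  have h1 : ∑ j ∈ window n, f (j + 1) = ∑ j ∈ Finset.Icc (-(n : ℤ) + 1) (n + 1), f j := by
    rw [window, ← Finset.map_add_right_Icc, Finset.sum_map]
    rfl
  have h2 : ∑ j ∈ Finset.Icc (-(n : ℤ)) (n + 1), f j =
      f (n + 1) + ∑ j ∈ window n, f j := by
    rw [← Finset.sum_insert (by simp [window])]
    congr 1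
    ext i
    simp only [window, Finset.mem_insert, Finset.mem_Icc]
    omega
  have h3 : ∑ j ∈ Finset.Icc (-(n : ℤ)) (n + 1), f j =
      f (-n) + ∑ j ∈ Finset.Icc (-(n : ℤ) + 1) (n + 1), f j := by
    rw [← Finset.sum_insert (by simp)]
    congr 1
    ext i
    simp only [Finset.mem_insert, Finset.mem_Icc]
    omega
  rw [h1, sub_eq_sub_iff_add_eq_add, ← h2, h3, add_comm]

/-- After cancellation two boundary translates remain, each of norm at most ‖T‖. -/
theorem norm_shiftMean_shiftConj_sub_le (n : ℕ) (T : ConfigSpace d →L[ℂ] ConfigSpace d) :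
    ‖shiftMean d n (shiftConj d 1 T) - shiftMean d n T‖ ≤ (2 * n + 1 : ℝ)⁻¹ * (2 * ‖T‖) := by
  rw [shiftMean_apply, shiftMean_apply, ← smul_sub, norm_smul, norm_inv_card_window]
  refine mul_le_mul_of_nonneg_left ?_ (by positivity)
  simp only [shiftConj_shiftConj]
  rw [sum_window_succ_sub n fun j => shiftConj d j T, two_mul]
  exact (norm_sub_le _ _).trans (add_le_add (norm_shiftConj_le _ T) (norm_shiftConj_le _ T))

variable [NeZero d]

/-- The sequence of compressed spatial means of an operator. -/
def meanSeq (n : ℕ → ℕ) :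
    (ConfigSpace d →L[ℂ] ConfigSpace d) →ₗ[ℂ] BddSeq (WindowAlg d n) where
  toFun T := ⟨fun k => compression (window (n k)) (fun _ => 0) (shiftMean d (n k) T),
    memℓp_infty ⟨‖T‖, by
      rintro _ ⟨k, rfl⟩
      exact (norm_compression_le _ _ _).trans (norm_shiftMean_le _ T)⟩⟩
  map_add' S T := lp.ext (funext fun k =>
    (congrArg _ (map_add (shiftMean d (n k)) S T)).trans (map_add _ _ _))
  map_smul' c T := lp.ext (funext fun k =>
    (congrArg _ (map_smul (shiftMean d (n k)) c T)).trans (map_smul _ _ _))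

theorem meanSeq_apply (n : ℕ → ℕ) (T : ConfigSpace d →L[ℂ] ConfigSpace d) (k : ℕ) :
    meanSeq n T k = compression (window (n k)) (fun _ => 0) (shiftMean d (n k) T) := rfl

theorem norm_meanSeq_le (n : ℕ → ℕ) (T : ConfigSpace d →L[ℂ] ConfigSpace d) :
    ‖meanSeq n T‖ ≤ ‖T‖ :=
  lp.norm_le_of_forall_le (norm_nonneg _) fun _ =>
    (norm_compression_le _ _ _).trans (norm_shiftMean_le _ T)

theorem meanSeq_one (n : ℕ → ℕ) : meanSeq (d := d) n 1 = 1 := by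
  refine lp.ext (funext fun k => ?_)
  rw [meanSeq_apply, shiftMean_one, ← map_one (localRep d (window (n k))), compression_localRep]
  rfl

/-- The translates of a one-site observable by sites of the window live inside the window, so
compression loses nothing and the macroscopic observable is recovered exactly. -/
theorem meanSeq_oneSite (n : ℕ → ℕ) (A : Matrix (Fin d) (Fin d) ℂ) :
    meanSeq n (oneSite A : quasiLocal d).1 = obsSeq n A := by
  refine lp.ext (funext fun k => ?_)
  rw [meanSeq_apply, shiftMean_oneSite, compression_localRep]
  rfl

/-- For a shift by one site the boundary error is of order 1/n_k and so lies in the null ideal.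
Since this holds for every T, it iterates to all shifts in both directions. -/
theorem mkₐ_meanSeq_shiftConj {n : ℕ → ℕ} (hn : StrictMono n)
    (T : ConfigSpace d →L[ℂ] ConfigSpace d) (j : ℤ) :
    SeqQuot.mkₐ _ (meanSeq n (shiftConj d j T)) = SeqQuot.mkₐ _ (meanSeq n T) := by
  have h1 : ∀ T : ConfigSpace d →L[ℂ] ConfigSpace d,
      SeqQuot.mkₐ _ (meanSeq n (shiftConj d 1 T)) = SeqQuot.mkₐ _ (meanSeq n T) := by
    intro T
    rw [SeqQuot.mkₐ_eq_iff, mem_nullIdeal, ← map_sub]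
    refine squeeze_zero (g := fun k => (2 * n k + 1 : ℝ)⁻¹ * (2 * ‖T‖)) (fun k => norm_nonneg _)
      (fun k => ?_) ?_
    · rw [meanSeq_apply, map_sub]
      exact (norm_compression_le _ _ _).trans (norm_shiftMean_shiftConj_sub_le (n k) T)
    · have h : Tendsto (fun k => 2 * (n k : ℝ) + 1) atTop atTop :=
        tendsto_atTop_add_const_right _ _
          ((tendsto_natCast_atTop_atTop.comp hn.tendsto_atTop).const_mul_atTop (by norm_num))
      simpa using h.inv_tendsto_atTop.mul_const (2 * ‖T‖)
  induction j using Int.induction_on with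
  | zero => rw [shiftConj_zero]
  | succ i ih => rw [add_comm, ← shiftConj_shiftConj, h1, ih]
  | pred i ih => rw [← ih, ← h1, shiftConj_shiftConj, add_sub_cancel]

end Averages

/-! ### Invariant states versus characters. -/

section InvariantStates

variable {d m : ℕ}

open scoped ComplexOrder

/-- A character of a closed unital `*`-subalgebra extends to a contractive functional. -/
theorem exists_contractive_extension {C : Type*} [CStarAlgebra C] (a : Fin m → C)
    (χ : WeakDual.characterSpace ℂ (generated a)) :
    ∃ F : C →ₗ[ℂ] ℂ, (∀ c, ‖F c‖ ≤ ‖c‖) ∧ F 1 = 1 ∧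
      ∀ i, F (a i) = χ ⟨a i, mem_generated a i⟩ := by
  let p : Subspace ℂ C := (generated a).toSubalgebra.toSubmodule
  have hχ : ∀ c : generated a, ‖χ c‖ ≤ ‖c‖ := by
    intro c
    have : Nontrivial (generated a) := ⟨1, 0, fun h => by
      have h1 : χ (1 : generated a) = 1 := map_one χ
      rw [h, map_zero] at h1
      exact zero_ne_one h1⟩
    exact spectrum.norm_le_norm_of_mem (WeakDual.CharacterSpace.apply_mem_spectrum χ c)
  let f : StrongDual ℂ p := LinearMap.mkContinuous
    { toFun := fun c => χ ⟨c.1, c.2⟩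
      map_add' := fun b c => map_add χ (⟨b.1, b.2⟩ : generated a) ⟨c.1, c.2⟩
      map_smul' := fun z c => map_smul χ z (⟨c.1, c.2⟩ : generated a) } 1
    (fun c => (hχ ⟨c.1, c.2⟩).trans (one_mul _).ge)
  have hf : ‖f‖ ≤ 1 := LinearMap.mkContinuous_norm_le _ zero_le_one _
  -- Hahn-Banach: F keeps the norm bound 1 but need not be multiplicative off the subalgebra.
  obtain ⟨F, hF, hFn⟩ := exists_extension_norm_eq p f
  refine ⟨F.toLinearMap, fun c => ?_, ?_, fun i => ?_⟩
  · exact (F.le_opNorm c).trans (mul_le_of_le_one_left (norm_nonneg _) (hFn.trans_le hf))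
  · exact (hF ⟨1, (generated a).one_mem⟩).trans (map_one χ)
  · exact hF ⟨a i, mem_generated a i⟩

/-- Every character of the algebra of macroscopic observables comes from an invariant state. -/
theorem exists_invariantState_of_character [NeZero d] (A : Fin m → Matrix (Fin d) (Fin d) ℂ)
    {n : ℕ → ℕ} (hn : StrictMono n)
    (χ : WeakDual.characterSpace ℂ (generated fun i => obs n (A i))) :
    ∃ ω : quasiLocal d →ₗ[ℂ] ℂ, IsInvariantState ω ∧
      ∀ i, ω (oneSite (A i)) = χ ⟨obs n (A i), mem_generated (fun i => obs n (A i)) i⟩ := by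
  obtain ⟨F, hF, hF1, hFa⟩ := exists_contractive_extension (fun i => obs n (A i)) χ
  -- The functional is defined on all bounded operators; the state is its restriction to 𝒜_ℤ. Taking
  -- means is not multiplicative, so positivity comes from contractivity and Φ(1) = 1.
  let Φ : (ConfigSpace d →L[ℂ] ConfigSpace d) →ₗ[ℂ] ℂ :=
    F ∘ₗ (SeqQuot.mkₐ (WindowAlg d n)).toLinearMap ∘ₗ meanSeq n
  have hΦ : ∀ T, Φ T = F (SeqQuot.mkₐ _ (meanSeq n T)) := fun _ => rfl
  have hΦ1 : Φ 1 = 1 := by rw [hΦ, meanSeq_one, map_one, hF1]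
  have hΦn : ∀ T, ‖Φ T‖ ≤ ‖T‖ := fun T =>
    (hF _).trans ((SeqQuot.norm_mkₐ_le _).trans (norm_meanSeq_le n T))
  refine ⟨Φ ∘ₗ (quasiLocal d).subtype.toLinearMap, ⟨fun a => ?_, hΦ1, fun j a => ?_⟩, fun i => ?_⟩
  · have h := nonneg_of_contractive_unital Φ hΦn hΦ1 a.1
    exact Complex.nonneg_iff.2 ⟨h.1, h.2.symm⟩
  · exact congrArg F (mkₐ_meanSeq_shiftConj hn a.1 j)
  · refine Eq.trans ?_ (hFa i)
    exact congrArg (fun b => F (SeqQuot.mkₐ _ b)) (meanSeq_oneSite n (A i))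

theorem posSemidef_densityMatrix {ω : quasiLocal d →ₗ[ℂ] ℂ} (hω : IsInvariantState ω) (n : ℕ) :
    (densityMatrix ω n).PosSemidef := by
  refine posSemidef_of_trace_mul_nonneg _ fun M => ?_
  rw [trace_densityMatrix_mul, map_mul, map_star]
  exact hω.nonneg _

theorem localEntropy_nonneg {ω : quasiLocal d →ₗ[ℂ] ℂ} (hω : IsInvariantState ω) (n : ℕ) :
    0 ≤ localEntropy ω n := by
  refine trace_cfc_negMulLog_nonneg (posSemidef_densityMatrix hω n) ?_
  rw [← mul_one (densityMatrix ω n), trace_densityMatrix_mul, map_one, hω.map_one]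

/-- Each term of the sequence is nonnegative, so the upper limit is too, whether or not the limit
exists. This is all that dom μ needs to know about entropy. -/
theorem meanEntropy_nonneg {ω : quasiLocal d →ₗ[ℂ] ℂ} (hω : IsInvariantState ω) :
    0 ≤ meanEntropy ω := by
  refine le_limsup_of_frequently_le (Eventually.frequently (Eventually.of_forall fun n => ?_))
  have h : 0 ≤ localEntropy ω n / (2 * n + 1) :=
    div_nonneg (localEntropy_nonneg hω n) (by positivity)
  exact_mod_cast h

/-- The effective domain of the entropy function consists of the expectations of the observables
in invariant states. -/
theorem mem_entropyDom_iff (A : Fin m → Matrix (Fin d) (Fin d) ℂ) (x : Fin m → ℝ) :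
    x ∈ entropyDom A ↔ ∃ ω : quasiLocal d →ₗ[ℂ] ℂ, IsInvariantState ω ∧
      ∀ i, ω (oneSite (A i)) = (x i : ℂ) := by
  constructor
  · intro h
    change ⊥ < entropyFn A x at h
    obtain ⟨_, ⟨ω, hω, hx, -⟩, -⟩ := lt_sSup_iff.1 h
    exact ⟨ω, hω, hx⟩
  · rintro ⟨ω, hω, hx⟩
    change ⊥ < entropyFn A x
    exact lt_sSup_iff.2 ⟨meanEntropy ω, ⟨ω, hω, hx, rfl⟩,
      (EReal.bot_lt_zero).trans_le (meanEntropy_nonneg hω)⟩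

/-- The one-site embedding `M_d(ℂ) → 𝒜_ℤ` as a `*`-homomorphism. -/
def oneSiteHom (d : ℕ) : Matrix (Fin d) (Fin d) ℂ →⋆ₐ[ℂ] quasiLocal d :=
  (incl d {0}).comp (siteEmb d {0} ⟨0, Finset.mem_singleton_self 0⟩)

/-- The one-site density matrix of an invariant state. -/
theorem exists_oneSite_density {ω : quasiLocal d →ₗ[ℂ] ℂ} (hω : IsInvariantState ω) :
    ∃ ρ : Matrix (Fin d) (Fin d) ℂ, ρ.PosSemidef ∧ ρ.trace = 1 ∧
      ∀ A, (ρ * A).trace = ω (oneSite A) := by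
  let p : Matrix (Fin d) (Fin d) ℂ →ₗ[ℂ] ℂ := ω ∘ₗ (oneSiteHom d).toLinearMap
  have hp : ∀ A, (functionalDensity p * A).trace = ω (oneSiteHom d A) :=
    trace_functionalDensity_mul p
  refine ⟨functionalDensity p, posSemidef_of_trace_mul_nonneg _ fun M => ?_, ?_, hp⟩
  · rw [hp, map_mul, map_star]
    exact hω.nonneg _
  · rw [← mul_one (functionalDensity p), hp, map_one, hω.map_one]

/-- The expectations of the observables in an invariant state are the joint value of a character
of the algebra of macroscopic observables. -/
theorem exists_character_of_invariantState [NeZero d] (A : Fin m → Matrix (Fin d) (Fin d) ℂ)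
    (hA : ∀ i, (A i).IsHermitian) {n : ℕ → ℕ} (hn : StrictMono n)
    {ω : quasiLocal d →ₗ[ℂ] ℂ} (hω : IsInvariantState ω) (x : Fin m → ℝ)
    (hx : ∀ i, ω (oneSite (A i)) = (x i : ℂ)) :
    ∃ χ : WeakDual.characterSpace ℂ (generated fun i => obs n (A i)),
      ∀ i, χ ⟨obs n (A i), mem_generated (fun i => obs n (A i)) i⟩ = (x i : ℂ) := by
  obtain ⟨ρ, hρ, htr, hρA⟩ := exists_oneSite_density hω
  -- An auxiliary cube large enough for both the observables and x. The characters do not depend on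
  -- its size, so no a priori bound on x is needed.
  set R : ℝ := ∑ i, (‖obs n (A i)‖ + |x i|)
  have hle : ∀ i, ‖obs n (A i)‖ + |x i| ≤ R := fun i =>
    Finset.single_le_sum (f := fun i => ‖obs n (A i)‖ + |x i|)
      (fun j _ => add_nonneg (norm_nonneg _) (abs_nonneg _)) (Finset.mem_univ i)
  have hR : ∀ i, ‖obs n (A i)‖ ≤ R := fun i =>
    (le_add_of_nonneg_right (abs_nonneg _)).trans (hle i)
  have hxR : x ∈ cube m R := fun i _ =>
    abs_le.1 ((le_add_of_nonneg_left (norm_nonneg _)).trans (hle i))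
  obtain ⟨χ, hχ⟩ := mem_range_jointCharacter_of_density A hA n hn R hR hρ htr ⟨x, hxR⟩
    fun i => (hρA (A i)).trans (hx i)
  refine ⟨χ, fun i => ?_⟩
  rw [character_eq_ofReal (fun i => obs n (A i)) (fun i => isSelfAdjoint_obs n (hA i)) R hR χ i, hχ]

/-- The support of the calculus is the range of `jointCharacter`. Membership of x in the cube is
automatic for joint values, because characters are contractive and ‖a_i‖ ≤ ‖A_i‖ < R. -/
theorem mem_jointSpectrum_iff [NeZero d] (A : Fin m → Matrix (Fin d) (Fin d) ℂ)
    (hA : ∀ i, (A i).IsHermitian) (n : ℕ → ℕ) (hn : StrictMono n) (R : ℝ) (hR : ∀ i, ‖A i‖ < R)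
    (x : Fin m → ℝ) :
    x ∈ jointSpectrum A hA n hn R hR ↔
      ∃ χ : WeakDual.characterSpace ℂ (generated fun i => obs n (A i)),
        ∀ i, χ ⟨obs n (A i), mem_generated (fun i => obs n (A i)) i⟩ = (x i : ℂ) := by
  have hsa : ∀ i, IsSelfAdjoint (obs n (A i)) := fun i => isSelfAdjoint_obs n (hA i)
  have hcomm : ∀ i j, Commute (obs n (A i)) (obs n (A j)) := fun i j => obs_commute hn (A i) (A j)
  have hR' : ∀ i, ‖obs n (A i)‖ ≤ R := fun i => (norm_obs_le n (A i)).trans (hR i).le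
  have hval := character_eq_ofReal (fun i => obs n (A i)) hsa R hR'
  constructor
  · rintro ⟨hx, h⟩
    obtain ⟨χ, hχ⟩ := (mem_range_jointCharacter_iff _ hsa hcomm R hR' ⟨x, hx⟩).2 h
    exact ⟨χ, fun i => by rw [hval, hχ]⟩
  · rintro ⟨χ, hχ⟩
    have hx : (jointCharacter (fun i => obs n (A i)) R hR' χ).1 = x :=
      funext fun i => Complex.ofReal_injective ((hval χ i).symm.trans (hχ i))
    subst hx
    exact ⟨Subtype.property _, (mem_range_jointCharacter_iff _ hsa hcomm R hR' _).1 ⟨χ, rfl⟩⟩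

end InvariantStates

end SpinChain
end

theorem lemma3p1 {d m : ℕ} [NeZero d] (A : Fin m → Matrix (Fin d) (Fin d) ℂ)
    (hA : ∀ i, (A i).IsHermitian) (n : ℕ → ℕ) (hn : StrictMono n)
    (R : ℝ) (hR : ∀ i, ‖A i‖ < R) :
    SpinChain.entropyDom A = SpinChain.jointSpectrum A hA n hn R hR := by
  ext x
  rw [SpinChain.mem_entropyDom_iff, SpinChain.mem_jointSpectrum_iff]
  constructor
  · rintro ⟨ω, hω, hx⟩
    exact SpinChain.exists_character_of_invariantState A hA hn hω x hx
  · rintro ⟨χ, hχ⟩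
    obtain ⟨ω, hω, h⟩ := SpinChain.exists_invariantState_of_character A hn χ
    exact ⟨ω, hω, fun i => (h i).trans (hχ i)⟩
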